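/- Let $d\in\{1,2,3\}$ and let $\Omega\subset\mathbb{R}^d$ be a non-empty, connected, bounded open set with $C^2$ boundary. Let $q^\dagger\in L^\infty(\Omega)$ satisfy $q^\dagger\ge 0$ a.e. and $\int_\Omega q^\dagger>0$ (for instance $q^\dagger>0$ a.e.), let $f\in H^{3/2}(\partial\Omega)$ be positive on $\partial\Omega$, and let $u^\dagger\in H^2(\Omega)$ be the strong solution of $$-\Delta u^\dagger+q^\dagger u^\dagger=0\ \text{ in }\Omega,\qquad u^\dagger=f\ \text{ on }\partial\Omega .$$ Let $H^2(\Omega;L^2(\Omega))$ be the space of $F\in L^2(\Omega;L^2(\Omega))$ whose weak derivatives $D^\alpha F$, $|\alpha|\le 2$, belong to $L^2(\Omega;L^2(\Omega))$; write $F(x,y)=F(x)(y)$. For $w\in H^2(\Omega)$ and $p\in L^2(\Omega)$ let $w\otimes p\in H^2(\Omega;L^2(\Omega))$ be the function $x\mapsto w(x)\,p$. The rank of $F\in H^2(\Omega;L^2(\Omega))$ is the rank of the associated Hilbert--Schmidt operator $$H^2(\Omega)\to L^2(\Omega),\qquad a\mapsto\sum_{|\alpha|\le 2}\int_\Omega D^\alpha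 a(x)\,D^\alpha F(x)\,dx ,$$ which for $F=w\otimes p$ is $a\mapsto\langle w,a\rangle_{H^2(\Omega)}\,p$. Let $F|_{\mathrm{diag}}\in L^2(\Omega)$ be the restriction of $F$ to the diagonal: for a.e. $y\in\Omega$, $F|_{\mathrm{diag}}(y)$ is the value at $y$ of the continuous representative of $F(\cdot,y)\in H^2(\Omega)$ (which exists because $d\le 3$). Let $\tilde f\in H^2(\Omega)$ be the harmonic extension of $f$. For $F\in H^2(\Omega;L^2(\Omega))$ let $u_F\in H^2(\Omega)$ be the unique solution of $$\Delta u_F=F|_{\mathrm{diag}}\ \text{ in }\Omega,\qquad u_F=f\ \text{ on }\partial\Omega,$$ put $v_F=u_F-\tilde f$, and define $$\Phi F=\Big(v_F,\ \int_\Omega F(\cdot,y)\,dy\Big),\qquad z=\Big(u^\dagger-\tilde f,\ \Big[\int_\Omega q^\dagger\Big]u^\dagger\Big).$$ Then $F^\dagger=u^\dagger\otimes q^\dagger$ is the unique solution of the problem $$\text{find } F\in H^2(\Omega;L^2(\Omega))\ \text{ such that }\ \Phi F=z\ \text{ and }\ \operatorname{rank}(F)=1 ;$$ that is, $F^\dagger$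 satisfies both conditions, and every $F\in H^2(\Omega;L^2(\Omega))$ that satisfies both conditions equals $F^\dagger$. -/

import Mathlib

open MeasureTheory Set
open scoped ContDiff ENNReal

noncomputable section

namespace InternalLifting

/-- The Euclidean space `ℝ^d`. -/
abbrev Space (d : ℕ) : Type := EuclideanSpace ℝ (Fin d)

/-- A set has a boundary of class `C²`: near each boundary point it is the strict sublevel set of a
`C²` function with non-vanishing differential (by the implicit function theorem, this is the same as
lying locally on one side of the graph of a `C²` function). -/
def HasC2Boundary {d : ℕ} (S : Set (Space d)) : Prop :=
  ∀ x₀ ∈ frontier S, ∃ (U : Set (Space d)) (ρ : Space d → ℝ), IsOpen U ∧ x₀ ∈ U ∧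
    ContDiffOn ℝ 2 ρ U ∧ (∀ x ∈ U, fderiv ℝ ρ x ≠ 0) ∧ S ∩ U = {x ∈ U | ρ x < 0}

/-- A (non-empty) connected bounded open subset of `ℝ^d` with `C²` boundary. -/
structure C2Domain (d : ℕ) where
  carrier : Set (Space d)
  isOpen : IsOpen carrier
  isConnected : IsConnected carrier
  isBounded : Bornology.IsBounded carrier
  hasC2Boundary : HasC2Boundary carrier

variable {d : ℕ} (Ω : C2Domain d)

/-- Lebesgue measure on `Ω`. -/
abbrev C2Domain.vol : Measure (Space d) := volume.restrict Ω.carrier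

instance : IsFiniteMeasure Ω.vol :=
  ⟨by simpa using Ω.isBounded.measure_lt_top⟩

/-- The Lebesgue–Bochner space `L²(Ω; V)`. -/
abbrev L2V (V : Type*) [NormedAddCommGroup V] : Type _ := Lp V 2 Ω.vol

/-- The real Lebesgue space `L²(Ω)`. -/
abbrev L2 : Type := Lp ℝ 2 Ω.vol

/-- The classical iterated partial derivative `∂_{i₁} ⋯ ∂_{iₖ} φ` for `l = [i₁, …, iₖ]`. -/
def partialDeriv : List (Fin d) → (Space d → ℝ) → (Space d → ℝ)
  | [], φ => φ
  | i :: l, φ => fun x => fderiv ℝ (partialDeriv l φ) x (EuclideanSpace.single i 1)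

/-- `φ ∈ C_c^∞(Ω)`. -/
structure IsTestFunction (φ : Space d → ℝ) : Prop where
  contDiff : ContDiff ℝ ∞ φ
  hasCompactSupport : HasCompactSupport φ
  tsupport_subset : tsupport φ ⊆ Ω.carrier

section Sobolev

variable {V : Type*} [NormedAddCommGroup V] [NormedSpace ℝ V]

/-- `G ∈ L²(Ω; V)` is the weak derivative `∂_{i₁} ⋯ ∂_{iₖ} F` of `F ∈ L²(Ω; V)`,
where `l = [i₁, …, iₖ]`. -/
def HasWeakDeriv (l : List (Fin d)) (F G : L2V Ω V) : Prop :=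
  ∀ φ : Space d → ℝ, IsTestFunction Ω φ →
    ∫ x, partialDeriv l φ x • F x ∂Ω.vol = (-1 : ℝ) ^ l.length • ∫ x, φ x • G x ∂Ω.vol

theorem contDiff_partialDeriv {φ : Space d → ℝ} (hφ : IsTestFunction Ω φ) (l : List (Fin d)) :
    ContDiff ℝ ∞ (partialDeriv l φ) ∧ HasCompactSupport (partialDeriv l φ) := by
  induction l with
  | nil => exact ⟨hφ.contDiff, hφ.hasCompactSupport⟩
  | cons i l ih =>
    refine ⟨?_, ?_⟩
    · exact (ih.1.fderiv_right (m := ∞) (by simp)).clm_apply contDiff_const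
    · exact (ih.2.fderiv (𝕜 := ℝ)).comp_left
        (g := fun T : Space d →L[ℝ] ℝ => T (EuclideanSpace.single i 1)) (by simp)

theorem integrable_partialDeriv_smul {φ : Space d → ℝ} (hφ : IsTestFunction Ω φ)
    (l : List (Fin d)) (F : L2V Ω V) :
    Integrable (fun x => partialDeriv l φ x • F x) Ω.vol := by
  obtain ⟨h1, h2⟩ := contDiff_partialDeriv Ω hφ l
  have hF : Integrable F Ω.vol := (Lp.memLp F).integrable (by norm_num)
  obtain ⟨C, hC⟩ := h2.exists_bound_of_continuous h1.continuous
  exact hF.bdd_smul C h1.continuous.aestronglyMeasurable (Filter.Eventually.of_forall hC)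

theorem integrable_test_smul {φ : Space d → ℝ} (hφ : IsTestFunction Ω φ) (F : L2V Ω V) :
    Integrable (fun x => φ x • F x) Ω.vol :=
  integrable_partialDeriv_smul Ω hφ [] F

variable {Ω}

theorem HasWeakDeriv.add {l : List (Fin d)} {F G F' G' : L2V Ω V}
    (h : HasWeakDeriv Ω l F G) (h' : HasWeakDeriv Ω l F' G') :
    HasWeakDeriv Ω l (F + F') (G + G') := by
  intro φ hφ
  have e1 : ∫ x, partialDeriv l φ x • (F + F') x ∂Ω.vol
      = ∫ x, (partialDeriv l φ x • F x + partialDeriv l φ x • F' x) ∂Ω.vol := by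
    refine integral_congr_ae ?_
    filter_upwards [Lp.coeFn_add F F'] with x hx
    rw [hx, Pi.add_apply, smul_add]
  have e2 : ∫ x, φ x • (G + G') x ∂Ω.vol = ∫ x, (φ x • G x + φ x • G' x) ∂Ω.vol := by
    refine integral_congr_ae ?_
    filter_upwards [Lp.coeFn_add G G'] with x hx
    rw [hx, Pi.add_apply, smul_add]
  rw [e1, e2, integral_add (integrable_partialDeriv_smul Ω hφ l F)
    (integrable_partialDeriv_smul Ω hφ l F'),
    integral_add (integrable_test_smul Ω hφ G)
    (integrable_test_smul Ω hφ G'), smul_add, h φ hφ, h' φ hφ]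

theorem HasWeakDeriv.smul {l : List (Fin d)} {F G : L2V Ω V} (c : ℝ)
    (h : HasWeakDeriv Ω l F G) : HasWeakDeriv Ω l (c • F) (c • G) := by
  intro φ hφ
  have e1 : ∫ x, partialDeriv l φ x • (c • F) x ∂Ω.vol
      = ∫ x, c • (partialDeriv l φ x • F x) ∂Ω.vol := by
    refine integral_congr_ae ?_
    filter_upwards [Lp.coeFn_smul c F] with x hx
    rw [hx, Pi.smul_apply, smul_comm]
  have e2 : ∫ x, φ x • (c • G) x ∂Ω.vol = ∫ x, c • (φ x • G x) ∂Ω.vol := by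
    refine integral_congr_ae ?_
    filter_upwards [Lp.coeFn_smul c G] with x hx
    rw [hx, Pi.smul_apply, smul_comm]
  rw [e1, e2, integral_smul, integral_smul, h φ hφ, smul_comm]

theorem HasWeakDeriv.zero (l : List (Fin d)) : HasWeakDeriv Ω l (0 : L2V Ω V) 0 := by
  have h : ∀ ψ : Space d → ℝ, ∫ x, ψ x • (0 : L2V Ω V) x ∂Ω.vol = 0 := by
    intro ψ
    refine integral_eq_zero_of_ae ?_
    filter_upwards [Lp.coeFn_zero V 2 Ω.vol] with x hx
    rw [hx]; simp
  intro φ _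
  rw [h, h, smul_zero]

theorem HasWeakDeriv.unique [CompleteSpace V] {l : List (Fin d)} {F G G' : L2V Ω V}
    (h : HasWeakDeriv Ω l F G) (h' : HasWeakDeriv Ω l F G') : G = G' := by
  have hi : ∀ H : L2V Ω V, Integrable H Ω.vol := fun H => (Lp.memLp H).integrable (by norm_num)
  have key : ∀ᵐ x ∂volume, x ∈ Ω.carrier → G x - G' x = 0 := by
    refine Ω.isOpen.ae_eq_zero_of_integral_contDiff_smul_eq_zero ?_ ?_
    · exact IntegrableOn.locallyIntegrableOn ((hi G).sub (hi G'))
    · intro φ h1 h2 h3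
      have ht : IsTestFunction Ω φ := ⟨h1, h2, h3⟩
      have e : ∫ x, φ x • (G x - G' x) ∂volume = ∫ x, φ x • (G x - G' x) ∂Ω.vol := by
        refine (setIntegral_eq_integral_of_forall_compl_eq_zero ?_).symm
        intro x hx
        have : φ x = 0 := by
          by_contra hne
          exact hx (h3 (subset_tsupport φ hne))
        rw [this, zero_smul]
      have e3 := (h φ ht).symm.trans (h' φ ht)
      have e4 : ∫ x, φ x • G x ∂Ω.vol = ∫ x, φ x • G' x ∂Ω.vol :=
        smul_right_injective V (pow_ne_zero _ (by norm_num)) e3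
      rw [e]
      simp only [smul_sub]
      rw [integral_sub (integrable_test_smul Ω ht G)
        (integrable_test_smul Ω ht G')]
      exact sub_eq_zero.2 e4
  refine Lp.ext ?_
  filter_upwards [(ae_restrict_iff' Ω.isOpen.measurableSet).2 key] with x hx
  exact sub_eq_zero.1 hx

theorem HasWeakDeriv.map {W : Type*} [NormedAddCommGroup W] [NormedSpace ℝ W]
    [CompleteSpace V] [CompleteSpace W] (T : V →L[ℝ] W)
    {l : List (Fin d)} {F G : L2V Ω V} (h : HasWeakDeriv Ω l F G) :
    HasWeakDeriv Ω l (T.compLp F) (T.compLp G) := by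
  have key : ∀ (H : L2V Ω V) {φ : Space d → ℝ} (_ : IsTestFunction Ω φ) (k : List (Fin d)),
      ∫ x, partialDeriv k φ x • (T.compLp H) x ∂Ω.vol
        = T (∫ x, partialDeriv k φ x • H x ∂Ω.vol) := by
    intro H φ hφ k
    rw [← T.integral_comp_comm (integrable_partialDeriv_smul Ω hφ k H)]
    refine integral_congr_ae ?_
    filter_upwards [T.coeFn_compLp H] with x hx
    rw [hx, T.map_smul]
  intro φ hφ
  rw [key F hφ l, h φ hφ, T.map_smul]
  exact congrArg _ (key G hφ []).symm

variable (Ω) (V)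

/-- The Sobolev space `H^m(Ω; V)`: the functions in `L²(Ω; V)` all of whose weak derivatives of
order at most `m` are in `L²(Ω; V)`. -/
def Sobolev (m : ℕ) : Submodule ℝ (L2V Ω V) where
  carrier := {F | ∀ l : List (Fin d), l.length ≤ m → ∃ G, HasWeakDeriv Ω l F G}
  add_mem' := by
    intro F F' hF hF' l hl
    obtain ⟨G, hG⟩ := hF l hl
    obtain ⟨G', hG'⟩ := hF' l hl
    exact ⟨_, hG.add hG'⟩
  zero_mem' := fun l _ => ⟨_, HasWeakDeriv.zero l⟩
  smul_mem' := by
    intro c F hF l hl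
    obtain ⟨G, hG⟩ := hF l hl
    exact ⟨_, hG.smul c⟩

/-- The Bochner–Sobolev space `H²(Ω; V)`. -/
abbrev H2V : Type _ := Sobolev Ω V 2

/-- The real Sobolev space `H²(Ω)`. -/
abbrev H2 : Type := Sobolev Ω ℝ 2

variable {Ω} {V}

open Classical in
/-- The weak derivative `∂_{i₁} ⋯ ∂_{iₖ} F ∈ L²(Ω; V)`, where `l = [i₁, …, iₖ]` (it exists, and is
unique, for `F ∈ H^m(Ω; V)` and `k ≤ m`). -/
def weakDeriv (l : List (Fin d)) (F : L2V Ω V) : L2V Ω V :=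
  if h : ∃ G, HasWeakDeriv Ω l F G then h.choose else 0

theorem hasWeakDeriv_weakDeriv {l : List (Fin d)} {m : ℕ} (F : Sobolev Ω V m)
    (hl : l.length ≤ m) : HasWeakDeriv Ω l (F : L2V Ω V) (weakDeriv l (F : L2V Ω V)) := by
  have h := F.2 l hl
  rw [weakDeriv, dif_pos h]
  exact h.choose_spec

/-- Composition of an `H²` function with a bounded linear operator. -/
def H2V.map {W : Type*} [NormedAddCommGroup W] [NormedSpace ℝ W] [CompleteSpace V]
    [CompleteSpace W] (T : V →L[ℝ] W) (F : H2V Ω V) : H2V Ω W :=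
  ⟨T.compLp (F : L2V Ω V), fun l hl => by
    obtain ⟨G, hG⟩ := F.2 l hl
    exact ⟨_, hG.map T⟩⟩

end Sobolev

variable {Ω}

/-- The elementary tensor `w ⊗ p ∈ H²(Ω; L²(Ω))`, i.e. the function `x ↦ w(x) p ∈ L²(Ω)`. -/
def tensor (w : H2 Ω) (p : L2 Ω) : H2V Ω (L2 Ω) :=
  H2V.map (ContinuousLinearMap.toSpanSingleton ℝ p) w

section Operator

/-- `∫_Ω (∂_l a)(x) (∂_l F)(x) dx ∈ L²(Ω)`. -/
def pairing (F : H2V Ω (L2 Ω)) (l : List (Fin d)) (a : H2 Ω) : L2 Ω :=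
  ∫ x, weakDeriv l (a : L2 Ω) x • weakDeriv l (F : L2V Ω (L2 Ω)) x ∂Ω.vol

theorem integrable_pairing (a : L2 Ω) (F : L2V Ω (L2 Ω)) :
    Integrable (fun x => a x • F x) Ω.vol :=
  memLp_one_iff_integrable.1 ((Lp.memLp F).smul (Lp.memLp a))

theorem pairing_add (F : H2V Ω (L2 Ω)) {l : List (Fin d)} (hl : l.length ≤ 2) (a b : H2 Ω) :
    pairing F l (a + b) = pairing F l a + pairing F l b := by
  have h : weakDeriv l ((a + b : H2 Ω) : L2 Ω)
      = weakDeriv l (a : L2 Ω) + weakDeriv l (b : L2 Ω) :=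
    (hasWeakDeriv_weakDeriv (a + b) hl).unique
      ((hasWeakDeriv_weakDeriv a hl).add (hasWeakDeriv_weakDeriv b hl))
  unfold pairing
  rw [h, ← integral_add (integrable_pairing _ _) (integrable_pairing _ _)]
  refine integral_congr_ae ?_
  filter_upwards [Lp.coeFn_add (weakDeriv l (a : L2 Ω)) (weakDeriv l (b : L2 Ω))] with x hx
  rw [hx, Pi.add_apply, add_smul]

theorem pairing_smul (F : H2V Ω (L2 Ω)) {l : List (Fin d)} (hl : l.length ≤ 2) (c : ℝ)
    (a : H2 Ω) : pairing F l (c • a) = c • pairing F l a := by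
  have h : weakDeriv l ((c • a : H2 Ω) : L2 Ω) = c • weakDeriv l (a : L2 Ω) :=
    (hasWeakDeriv_weakDeriv (c • a) hl).unique ((hasWeakDeriv_weakDeriv a hl).smul c)
  unfold pairing
  rw [h, ← integral_smul]
  refine integral_congr_ae ?_
  filter_upwards [Lp.coeFn_smul c (weakDeriv l (a : L2 Ω))] with x hx
  rw [hx, Pi.smul_apply, smul_eq_mul, mul_smul]

/-- The Hilbert–Schmidt operator `H²(Ω) → L²(Ω)` associated with `F ∈ H²(Ω; L²(Ω))`,
`a ↦ ∑_{|α| ≤ 2} ∫_Ω D^α a(x) D^α F(x) dx`. The identification sends `w ⊗ p` to the rank-one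
operator `a ↦ ⟨w, a⟩_{H²(Ω)} p`. The multi-indices of order at most two are `0`, `e_i`, and
`e_i + e_j` with `i ≤ j`. -/
def hsOperator (F : H2V Ω (L2 Ω)) : H2 Ω →ₗ[ℝ] L2 Ω where
  toFun a := pairing F [] a + ∑ i : Fin d, pairing F [i] a
    + ∑ i : Fin d, ∑ j ∈ Finset.Ici i, pairing F [i, j] a
  map_add' a b := by
    have h0 : pairing F [] (a + b) = pairing F [] a + pairing F [] b :=
      pairing_add F (by simp) a b
    have h1 : ∀ i : Fin d, pairing F [i] (a + b) = pairing F [i] a + pairing F [i] b :=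
      fun i => pairing_add F (by simp) a b
    have h2 : ∀ i j : Fin d, pairing F [i, j] (a + b) = pairing F [i, j] a + pairing F [i, j] b :=
      fun i j => pairing_add F (by simp) a b
    simp only [h0, h1, h2, Finset.sum_add_distrib]
    abel
  map_smul' c a := by
    have h0 : pairing F [] (c • a) = c • pairing F [] a := pairing_smul F (by simp) c a
    have h1 : ∀ i : Fin d, pairing F [i] (c • a) = c • pairing F [i] a :=
      fun i => pairing_smul F (by simp) c a
    have h2 : ∀ i j : Fin d, pairing F [i, j] (c • a) = c • pairing F [i, j] a :=
      fun i j => pairing_smul F (by simp) c a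
    simp only [h0, h1, h2, ← Finset.smul_sum, RingHom.id_apply, smul_add]

/-- The rank of `F ∈ H²(Ω; L²(Ω))` is the rank of the associated Hilbert–Schmidt operator. -/
def rank (F : H2V Ω (L2 Ω)) : Cardinal := LinearMap.rank (hsOperator F)

end Operator

/-- `g` is the restriction of `F ∈ H²(Ω; L²(Ω)) ≅ L²(Ω; H²(Ω))` to the diagonal of `Ω × Ω`:
`F` is represented by a jointly measurable function `Φ(x, y) = F(x)(y)` such that, for almost every `y`, the
slice `Φ(·, y)` is the continuous representative of `F(·, y) ∈ H²(Ω)`, and `g(y) = Φ(y, y)`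
is the value of that representative at `y`. -/
def IsDiagRestriction (F : H2V Ω (L2 Ω)) (g : L2 Ω) : Prop :=
  ∃ Φ : Space d → Space d → ℝ,
    AEStronglyMeasurable (Function.uncurry Φ) (Ω.vol.prod Ω.vol) ∧
    (∀ᵐ x ∂Ω.vol, Φ x =ᵐ[Ω.vol] ((F : L2V Ω (L2 Ω)) x : Space d → ℝ)) ∧
    (∀ᵐ y ∂Ω.vol, ContinuousOn (fun x => Φ x y) Ω.carrier) ∧
    ∀ᵐ y ∂Ω.vol, g y = Φ y y

open Classical in
/-- The diagonal restriction `H²(Ω; L²(Ω)) → L²(Ω)`. In dimension `d ≤ 3` the restriction exists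
for every `F`, because `H²(Ω)` embeds in the bounded continuous functions. -/
def diagRestriction (F : H2V Ω (L2 Ω)) : L2 Ω :=
  if h : ∃ g, IsDiagRestriction F g then h.choose else 0

/-- The (weak) Laplacian `H²(Ω) → L²(Ω)`. -/
def laplacian (u : H2 Ω) : L2 Ω := ∑ i : Fin d, weakDeriv [i, i] (u : L2 Ω)

/-- `u = f` on `∂Ω`. In dimension `d ≤ 3` every `u ∈ H²(Ω)` has a representative that is continuous
on the closure of `Ω`, and the trace of `u` is the restriction of that representative to `∂Ω`. -/
def HasTrace (u : H2 Ω) (f : Space d → ℝ) : Prop :=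
  ∃ U : Space d → ℝ, ContinuousOn U (closure Ω.carrier) ∧
    U =ᵐ[Ω.vol] ((u : L2 Ω) : Space d → ℝ) ∧ ∀ x ∈ frontier Ω.carrier, U x = f x

/-- `u ∈ H²(Ω)` is a strong solution of `-Δu + q u = 0` in `Ω`, `u = f` on `∂Ω`. -/
def IsStrongSolution (q : L2 Ω) (f : Space d → ℝ) (u : H2 Ω) : Prop :=
  (∀ᵐ x ∂Ω.vol, -laplacian u x + q x * (u : L2 Ω) x = 0) ∧ HasTrace u f

open Classical in
/-- The unique solution `u ∈ H²(Ω)` of the Poisson problem `Δu = g` in `Ω`, `u = f` on `∂Ω`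
(it exists for all `g ∈ L²(Ω)` and all traces `f` of `H²(Ω)` functions). -/
def poissonSolution (g : L2 Ω) (f : Space d → ℝ) : H2 Ω :=
  if h : ∃ u : H2 Ω, laplacian u = g ∧ HasTrace u f then h.choose else 0

/-- The harmonic extension of the boundary datum `f`. -/
def harmonicExtension (f : Space d → ℝ) : H2 Ω := poissonSolution 0 f

/-- `u_F`, the solution of `Δu_F = F|_diag` in `Ω`, `u_F = f` on `∂Ω`. -/
def liftedState (f : Space d → ℝ) (F : H2V Ω (L2 Ω)) : H2 Ω :=
  poissonSolution (diagRestriction F) f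

/-- The bounded linear functional `p ↦ ∫_Ω p` on `L²(Ω)`. -/
def integralL2 : L2 Ω →L[ℝ] ℝ where
  toFun p := ∫ y, p y ∂Ω.vol
  map_add' p r := by
    rw [← integral_add ((Lp.memLp p).integrable (by norm_num))
      ((Lp.memLp r).integrable (by norm_num))]
    exact integral_congr_ae (Lp.coeFn_add p r)
  map_smul' c p := by
    rw [RingHom.id_apply, ← integral_smul]
    exact integral_congr_ae (Lp.coeFn_smul c p)
  cont := by
    have h : (fun p : L2 Ω => ∫ y, p y ∂Ω.vol)
        = fun p => inner ℝ (indicatorConstLp 2 MeasurableSet.univ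
            (measure_ne_top Ω.vol univ) (1 : ℝ)) p := by
      funext p
      rw [L2.inner_indicatorConstLp_one, setIntegral_univ]
    exact h ▸ (by fun_prop)

/-- The measurement operator `F ↦ (v_F, ∫_Ω F(·, y) dy)`, where `v_F = u_F - f̃`. -/
def measurement (f : Space d → ℝ) (F : H2V Ω (L2 Ω)) : H2 Ω × H2 Ω :=
  (liftedState f F - harmonicExtension f, H2V.map integralL2 F)

end InternalLifting

end

/-!
The pair of measurements determines a rank-one `F`, and the two factors are recovered one after the
other.

*Rank one means elementary tensor.* If the range of the Hilbert–Schmidt operator of `F` is spanned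
by `p` and `r ⟂ p`, then testing that operator with the slice `a = ⟨r, F(·)⟩ ∈ H²(Ω)` gives
`‖⟨r, F(·)⟩‖_{H²}² = 0` (`ae_inner_eq_zero_of_forall_inner_hsOperator`). Hence almost every value of
`F` is a multiple of `p`, and `F = w ⊗ p` with `w ∈ H²(Ω)` (`exists_eq_tensor_of_rank_eq_one`).

*The factors.* The second measurement says `(∫ p) w = (∫ q) u`, so that `F = u ⊗ p'` for a multiple
`p'` of `p`. The diagonal of `u ⊗ p'` is `u p'`, computed with the continuous representative of `u`
(`isDiagRestriction_tensor`); it is the only possible diagonal (`IsDiagRestriction.unique`). The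
first measurement says `u_F = u`, so `u p' = Δu = q u`, and `p' = q` because `u` vanishes nowhere.
That `u_F` solves its boundary value problem is read off from `u_F = u ≠ 0`, since `poissonSolution`
is `0` where no solution exists; the solvability theorem for `L²` data is not needed.

*Conversely*, the diagonal of `u ⊗ q` is `q u = Δu`, and `u` is the only solution of
`Δv = Δu` with its own boundary values (`poissonSolution_eq`).

Both facts about `u` that enter, uniqueness for the Poisson problem and positivity in `Ω`
(`IsStrongSolution.exists_pos_representative`), come from one weak minimum principle for continuous
distributional supersolutions (`nonneg_of_isWeaklySuperharmonic`), proved by mollification; no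
regularity theory is involved. Positivity follows from it by comparison with the barrier
`exp (-α |x - x₀|²) - exp (-α R²)` on annuli (`pos_on_ball_of_pos_on_closedBall`) and connectedness
of `Ω`.
-/

namespace InternalLifting

open Metric Filter Topology
open scoped Convolution

/-! ### Smooth functions and the classical Laplacian -/

section Classical

variable {d : ℕ}

/-- The classical Laplacian `∑ᵢ ∂ᵢ∂ᵢ φ`, in terms of `partialDeriv`. -/
noncomputable def classicalLaplacian (φ : Space d → ℝ) (x : Space d) : ℝ := ∑ i, partialDeriv [i, i] φ x

theorem _root_.ContDiff.partialDeriv {φ : Space d → ℝ} (hφ : ContDiff ℝ ∞ φ) (l : List (Fin d)) :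
    ContDiff ℝ ∞ (partialDeriv l φ) := by
  induction l with
  | nil => exact hφ
  | cons i l ih => exact (ih.fderiv_right (m := ∞) (by simp)).clm_apply contDiff_const

theorem tsupport_partialDeriv_subset (φ : Space d → ℝ) (l : List (Fin d)) :
    tsupport (partialDeriv l φ) ⊆ tsupport φ := by
  induction l with
  | nil => exact subset_rfl
  | cons i l ih =>
    refine (closure_mono ?_).trans ((tsupport_fderiv_subset ℝ).trans ih)
    intro x hx h0
    exact hx (by simp [partialDeriv, show fderiv ℝ (partialDeriv l φ) x = 0 from h0])

theorem _root_.HasCompactSupport.partialDeriv {φ : Space d → ℝ} (hφ : HasCompactSupport φ)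
    (l : List (Fin d)) : HasCompactSupport (partialDeriv l φ) :=
  hφ.of_isClosed_subset (isClosed_tsupport _) (tsupport_partialDeriv_subset φ l)

theorem contDiff_classicalLaplacian {φ : Space d → ℝ} (hφ : ContDiff ℝ ∞ φ) :
    ContDiff ℝ ∞ (classicalLaplacian φ) :=
  ContDiff.sum fun _ _ => ContDiff.partialDeriv hφ _

theorem tsupport_classicalLaplacian_subset (φ : Space d → ℝ) :
    tsupport (classicalLaplacian φ) ⊆ tsupport φ := by
  refine closure_minimal ?_ (isClosed_tsupport _)
  intro x hx
  by_contra h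
  refine hx (Finset.sum_eq_zero fun i _ => ?_)
  exact image_eq_zero_of_notMem_tsupport fun h' => h (tsupport_partialDeriv_subset φ _ h')

theorem hasCompactSupport_classicalLaplacian {φ : Space d → ℝ} (hφ : HasCompactSupport φ) :
    HasCompactSupport (classicalLaplacian φ) :=
  hφ.of_isClosed_subset (isClosed_tsupport _) (tsupport_classicalLaplacian_subset φ)

theorem partialDeriv_sub {φ ψ : Space d → ℝ} (hφ : ContDiff ℝ ∞ φ) (hψ : ContDiff ℝ ∞ ψ)
    (l : List (Fin d)) :
    partialDeriv l (fun x => φ x - ψ x) = fun x => partialDeriv l φ x - partialDeriv l ψ x := by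
  induction l with
  | nil => rfl
  | cons i l ih =>
    funext x
    simp only [partialDeriv, ih]
    rw [fderiv_fun_sub ((ContDiff.partialDeriv hφ l).differentiable (by simp) x)
      ((ContDiff.partialDeriv hψ l).differentiable (by simp) x)]
    rfl

theorem classicalLaplacian_sub {φ ψ : Space d → ℝ} (hφ : ContDiff ℝ ∞ φ) (hψ : ContDiff ℝ ∞ ψ)
    (x : Space d) :
    classicalLaplacian (fun x => φ x - ψ x) x
      = classicalLaplacian φ x - classicalLaplacian ψ x := by
  simp only [classicalLaplacian, partialDeriv_sub hφ hψ, Finset.sum_sub_distrib]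

theorem partialDeriv_const_mul {φ : Space d → ℝ} (hφ : ContDiff ℝ ∞ φ) (c : ℝ)
    (l : List (Fin d)) : partialDeriv l (fun x => c * φ x) = fun x => c * partialDeriv l φ x := by
  induction l with
  | nil => rfl
  | cons i l ih =>
    funext x
    simp only [partialDeriv, ih]
    rw [fderiv_const_mul ((hφ.partialDeriv l).differentiable (by simp) x)]
    rfl

theorem classicalLaplacian_const_mul {φ : Space d → ℝ} (hφ : ContDiff ℝ ∞ φ) (c : ℝ)
    (x : Space d) : classicalLaplacian (fun x => c * φ x) x = c * classicalLaplacian φ x := by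
  simp only [classicalLaplacian, partialDeriv_const_mul hφ, Finset.mul_sum]

theorem partialDeriv_comp_const_sub {φ : Space d → ℝ} (hφ : ContDiff ℝ ∞ φ) (x : Space d)
    (l : List (Fin d)) :
    partialDeriv l (fun t => φ (x - t)) = fun t => (-1) ^ l.length * partialDeriv l φ (x - t) := by
  induction l with
  | nil => simp [partialDeriv]
  | cons i l ih =>
    funext t
    simp only [partialDeriv, ih]
    have h1 : HasFDerivAt (partialDeriv l φ) (fderiv ℝ (partialDeriv l φ) (x - t)) (x - t) :=
      ((ContDiff.partialDeriv hφ l).differentiable (by simp) _).hasFDerivAt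
    have h2 : HasFDerivAt (fun t : Space d => x - t) (-ContinuousLinearMap.id ℝ (Space d)) t :=
      (hasFDerivAt_id t).const_sub x
    have h3 := (h1.comp t h2).const_mul ((-1 : ℝ) ^ l.length)
    have h4 : HasFDerivAt (fun t => (-1 : ℝ) ^ l.length * partialDeriv l φ (x - t)) _ t := h3
    rw [h4.fderiv]
    simp [pow_succ]

theorem partialDeriv_convolution {W ρ : Space d → ℝ} (hW : Continuous W) (hρ : ContDiff ℝ ∞ ρ)
    (hρc : HasCompactSupport ρ) (l : List (Fin d)) :
    partialDeriv l (W ⋆[ContinuousLinearMap.lsmul ℝ ℝ, volume] ρ)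
      = W ⋆[ContinuousLinearMap.lsmul ℝ ℝ, volume] partialDeriv l ρ := by
  induction l with
  | nil => rfl
  | cons i l ih =>
    funext x
    have h1 := ContDiff.partialDeriv hρ l
    have h2 := HasCompactSupport.partialDeriv hρc l
    have hW' : LocallyIntegrable W volume := hW.locallyIntegrable
    simp only [partialDeriv, ih]
    rw [(h2.hasFDerivAt_convolution_right (ContinuousLinearMap.lsmul ℝ ℝ) hW'
      (h1.of_le (by simp)) x).fderiv,
      convolution_precompR_apply _ hW' (h2.fderiv ℝ) (h1.continuous_fderiv (by simp))]

theorem second_deriv_nonneg_of_isLocalMin {g : ℝ → ℝ} {x : ℝ} (hg : ContinuousAt g x)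
    (hmin : IsLocalMin g x) : 0 ≤ deriv (deriv g) x := by
  by_contra! h
  -- a negative second derivative would make `x` a local maximum too, and `g` constant near `x`
  have hmax := isLocalMax_of_deriv_deriv_neg h hmin.deriv_eq_zero hg
  have hc : g =ᶠ[𝓝 x] fun _ => g x := by
    filter_upwards [hmin, hmax] with y h1 h2 using le_antisymm h2 h1
  have h1 : deriv g =ᶠ[𝓝 x] fun _ => 0 := by
    simpa using hc.deriv
  have h2 := h1.deriv_eq
  simp at h2
  linarith

theorem classicalLaplacian_nonneg_of_isLocalMin {G : Space d → ℝ} (hG : ContDiff ℝ ∞ G)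
    {x : Space d} (hmin : IsLocalMin G x) : 0 ≤ classicalLaplacian G x := by
  refine Finset.sum_nonneg fun i _ => ?_
  set e : Space d := EuclideanSpace.single i 1
  have hline : ∀ t : ℝ, HasDerivAt (fun t : ℝ => x + t • e) e t := fun t => by
    simpa using ((hasDerivAt_id t).smul_const e).const_add x
  have hcomp : ∀ {H : Space d → ℝ}, ContDiff ℝ ∞ H → ∀ t : ℝ,
      deriv (fun t : ℝ => H (x + t • e)) t = fderiv ℝ H (x + t • e) e := fun hH t =>
    (((hH.differentiable (by simp) _).hasFDerivAt).comp_hasDerivAt t (hline t)).deriv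
  have h1 : deriv (fun t : ℝ => G (x + t • e)) = fun t => partialDeriv [i] G (x + t • e) :=
    funext fun t => hcomp hG t
  have h2 : deriv (deriv fun t : ℝ => G (x + t • e)) 0 = partialDeriv [i, i] G x := by
    rw [h1, hcomp (ContDiff.partialDeriv hG [i])]
    simp [partialDeriv, e]
  rw [← h2]
  have hct : ContinuousAt (fun t : ℝ => x + t • e) 0 := (hline 0).continuousAt
  refine second_deriv_nonneg_of_isLocalMin (hG.continuous.continuousAt.comp hct) ?_
  have : Tendsto (fun t : ℝ => x + t • e) (𝓝 0) (𝓝 x) := by simpa [ContinuousAt] using hct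
  have h3 := this.eventually hmin
  simpa [IsLocalMin, IsMinFilter] using h3

theorem hasFDerivAt_norm_sub_sq (x₀ x : Space d) :
    HasFDerivAt (fun y : Space d => ‖y - x₀‖ ^ 2) (2 • innerSL ℝ (x - x₀)) x := by
  have h := ((hasFDerivAt_id x).sub_const x₀).norm_sq
  simpa using h

theorem partialDeriv_norm_sub_sq (x₀ : Space d) (i : Fin d) :
    partialDeriv [i] (fun y : Space d => ‖y - x₀‖ ^ 2) = fun y => 2 * (y i - x₀ i) := by
  funext x
  simp only [partialDeriv, (hasFDerivAt_norm_sub_sq x₀ x).fderiv]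
  simp [innerSL_apply_apply, EuclideanSpace.inner_single_right]

theorem hasFDerivAt_coord_sub (x₀ x : Space d) (i : Fin d) (c : ℝ) :
    HasFDerivAt (fun y : Space d => c * (y i - x₀ i))
      (c • (EuclideanSpace.proj i : Space d →L[ℝ] ℝ)) x := by
  have h := (((EuclideanSpace.proj i : Space d →L[ℝ] ℝ).hasFDerivAt (x := x)).sub_const
    (x₀ i)).const_mul c
  exact h

theorem classicalLaplacian_norm_sub_sq (x₀ x : Space d) :
    classicalLaplacian (fun y : Space d => ‖y - x₀‖ ^ 2) x = 2 * d := by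
  have h : ∀ i : Fin d, partialDeriv [i, i] (fun y : Space d => ‖y - x₀‖ ^ 2) x = 2 := fun i => by
    change fderiv ℝ (partialDeriv [i] _) x _ = 2
    rw [partialDeriv_norm_sub_sq, (hasFDerivAt_coord_sub x₀ x i 2).fderiv]
    simp
  simp [classicalLaplacian, h, mul_comm]

end Classical

/-! ### The weak maximum principle -/

section MaximumPrinciple

variable {d : ℕ}

/-- `φ` is an admissible non-negative test function for a differential inequality on `V`. -/
structure IsNonnegTest (V : Set (Space d)) (φ : Space d → ℝ) : Prop where
  contDiff : ContDiff ℝ ∞ φ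
  hasCompactSupport : HasCompactSupport φ
  tsupport_subset : tsupport φ ⊆ V
  nonneg : ∀ x, 0 ≤ φ x

/-- `ΔW ≤ 0` on `V` in the sense of distributions. -/
def IsWeaklySuperharmonic (V : Set (Space d)) (W : Space d → ℝ) : Prop :=
  ∀ φ, IsNonnegTest V φ → ∫ x, W x * classicalLaplacian φ x ≤ 0

theorem IsWeaklySuperharmonic.congr {V : Set (Space d)} {W W' : Space d → ℝ}
    (h : IsWeaklySuperharmonic V W) (hWW : EqOn W W' V) : IsWeaklySuperharmonic V W' := by
  intro φ hφ
  refine le_of_eq_of_le (integral_congr_ae (Eventually.of_forall fun x => ?_)) (h φ hφ)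
  by_cases hx : x ∈ V
  · simp only [hWW hx]
  · have : classicalLaplacian φ x = 0 := image_eq_zero_of_notMem_tsupport fun h' =>
      hx (hφ.tsupport_subset (tsupport_classicalLaplacian_subset φ h'))
    simp only [this, mul_zero]

/-- Mollification of a continuous weakly superharmonic function: a smooth function uniformly close
on a compact set, with non-positive Laplacian at all points at distance more than `δ` from `Vᶜ`. -/
theorem exists_smooth_approx {V : Set (Space d)} {W : Space d → ℝ} (hW : Continuous W)
    (hsup : IsWeaklySuperharmonic V W) {K : Set (Space d)} (hK : IsCompact K) {ε δ : ℝ}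
    (hε : 0 < ε) (hδ : 0 < δ) :
    ∃ g : Space d → ℝ, ContDiff ℝ ∞ g ∧ (∀ x ∈ K, dist (g x) (W x) ≤ ε) ∧
      ∀ x, closedBall x δ ⊆ V → classicalLaplacian g x ≤ 0 := by
  obtain ⟨η, hη, hηW⟩ : ∃ η > 0, ∀ x ∈ K, ∀ y, dist y x < η → dist (W y) (W x) ≤ ε := by
    have huc := (hK.cthickening (r := 1)).uniformContinuousOn_of_continuous hW.continuousOn
    obtain ⟨η, hη, h⟩ := Metric.uniformContinuousOn_iff.1 huc ε hε
    refine ⟨min η 1, lt_min hη one_pos, fun x hx y hy => (h y ?_ x ?_ ?_).le⟩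
    · exact mem_cthickening_of_dist_le _ x _ _ hx (hy.le.trans (min_le_right _ _))
    · exact self_subset_cthickening _ hx
    · exact hy.trans_le (min_le_left _ _)
  have hr : 0 < min η δ := lt_min hη hδ
  let b : ContDiffBump (0 : Space d) := ⟨min η δ / 2, min η δ, by positivity, by linarith⟩
  set ρ : Space d → ℝ := b.normed volume
  have hρ : ContDiff ℝ ∞ ρ := b.contDiff_normed
  have hρc : HasCompactSupport ρ := b.hasCompactSupport_normed
  refine ⟨W ⋆[ContinuousLinearMap.lsmul ℝ ℝ, volume] ρ,
    hρc.contDiff_convolution_right _ hW.locallyIntegrable hρ, fun x hx => ?_, fun x hx => ?_⟩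
  · have hcomm : (W ⋆[ContinuousLinearMap.lsmul ℝ ℝ, volume] ρ)
        = ρ ⋆[ContinuousLinearMap.lsmul ℝ ℝ, volume] W := by
      rw [← convolution_flip]
      congr 1
      ext
      simp
    rw [hcomm]
    exact b.dist_normed_convolution_le hW.aestronglyMeasurable
      fun y hy => hηW x hx y ((mem_ball.1 hy).trans_le (min_le_left _ _))
  · -- `Δ(W ⋆ ρ)(x)` is the pairing of `W` with the Laplacian of `t ↦ ρ (x - t)`
    set φ : Space d → ℝ := fun t => ρ (x - t)
    have hφ : ContDiff ℝ ∞ φ := hρ.comp (contDiff_const.sub contDiff_id)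
    have hsupp : tsupport φ ⊆ closedBall x δ := by
      refine closure_minimal (fun t ht => ?_) isClosed_closedBall
      have : x - t ∈ Function.support ρ := ht
      rw [b.support_normed_eq, mem_ball_zero_iff, ← dist_eq_norm] at this
      rw [mem_closedBall, dist_comm]
      exact this.le.trans (min_le_right _ _)
    have htest : IsNonnegTest V φ := ⟨hφ,
      (isCompact_closedBall x δ).of_isClosed_subset (isClosed_tsupport _) hsupp,
      hsupp.trans hx, fun t => b.nonneg_normed _⟩
    have hint : ∀ i : Fin d,
        Integrable (fun t => W t * partialDeriv [i, i] φ t) volume := fun i =>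
      (hW.mul (ContDiff.partialDeriv hφ [i, i]).continuous).integrable_of_hasCompactSupport
        (HasCompactSupport.partialDeriv htest.hasCompactSupport [i, i]).mul_left
    have key : classicalLaplacian (W ⋆[ContinuousLinearMap.lsmul ℝ ℝ, volume] ρ) x
        = ∫ t, W t * classicalLaplacian φ t := by
      simp only [classicalLaplacian, Finset.mul_sum]
      rw [integral_finsetSum _ fun i _ => hint i]
      refine Finset.sum_congr rfl fun i _ => ?_
      rw [partialDeriv_convolution hW hρ hρc, convolution_def]
      refine integral_congr_ae (Eventually.of_forall fun t => ?_)
      simp only [φ, partialDeriv_comp_const_sub hρ]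
      simp
    rw [key]
    exact hsup φ htest

/-- The minimum principle for weakly superharmonic functions that are continuous on the whole
space. -/
theorem nonneg_of_isWeaklySuperharmonic_of_continuous (hd : 1 ≤ d) {V : Set (Space d)}
    (hV : IsOpen V) (hVb : Bornology.IsBounded V) {W : Space d → ℝ} (hW : Continuous W)
    (hbd : ∀ x ∈ frontier V, 0 ≤ W x) (hsup : IsWeaklySuperharmonic V W) :
    ∀ x ∈ V, 0 ≤ W x := by
  intro x₁ hx₁
  by_contra! hneg
  have hK : IsCompact (closure V) := hVb.isCompact_closure
  obtain ⟨c, hc, hWc⟩ : ∃ c > 0, W x₁ = -c := ⟨-W x₁, by linarith, by ring⟩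
  obtain ⟨R, hR, hRK⟩ : ∃ R > 0, closure V ⊆ ball x₁ R := hK.isBounded.subset_ball_lt 0 x₁
  -- the points of `V` where `W` is negative enough have a positive distance to `Vᶜ`
  have hL : IsCompact (closure V ∩ {x | W x ≤ -c / 2}) :=
    hK.inter_right (isClosed_le hW continuous_const)
  have hLV : closure V ∩ {x | W x ≤ -c / 2} ⊆ V := by
    rintro x ⟨hx, hxc⟩
    by_contra hxV
    have := hbd x (by rw [hV.frontier_eq]; exact ⟨hx, hxV⟩)
    simp only [mem_ofPred_eq] at hxc
    linarith
  obtain ⟨δ, hδ, hδV⟩ := hL.exists_cthickening_subset_open hV hLV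
  obtain ⟨g, hg, hgW, hgΔ⟩ := exists_smooth_approx hW hsup hK (ε := c / 8) (by positivity) hδ
  -- the perturbation by `-η |x - x₁|²` makes the Laplacian strictly negative
  set η : ℝ := c / (4 * R ^ 2)
  have hη : 0 < η := by positivity
  have hq : ContDiff ℝ ∞ fun x : Space d => ‖x - x₁‖ ^ 2 :=
    (contDiff_id.sub contDiff_const).norm_sq ℝ
  have hηq : ContDiff ℝ ∞ fun x : Space d => η * ‖x - x₁‖ ^ 2 := contDiff_const.mul hq
  have hG : ContDiff ℝ ∞ fun x => g x - η * ‖x - x₁‖ ^ 2 := hg.sub hηq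
  obtain ⟨x₂, hx₂, hmin⟩ := hK.exists_isMinOn ⟨x₁, subset_closure hx₁⟩ hG.continuous.continuousOn
  have hx₂L : x₂ ∈ closure V ∩ {x | W x ≤ -c / 2} := by
    refine ⟨hx₂, ?_⟩
    have h1 := isMinOn_iff.1 hmin x₁ (subset_closure hx₁)
    have h2 := abs_le.1 (Real.dist_eq _ _ ▸ hgW x₁ (subset_closure hx₁))
    have h3 := abs_le.1 (Real.dist_eq _ _ ▸ hgW x₂ hx₂)
    have h4 : ‖x₂ - x₁‖ < R := by simpa [dist_eq_norm] using hRK hx₂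
    have h5 : η * ‖x₂ - x₁‖ ^ 2 ≤ c / 4 := by
      calc η * ‖x₂ - x₁‖ ^ 2 ≤ η * R ^ 2 := by gcongr
        _ = c / 4 := by simp only [η]; field_simp
    simp only [sub_self, norm_zero] at h1
    simp only [mem_ofPred_eq]
    norm_num at h1
    linarith [h2.1, h2.2, h3.1, h3.2]
  have hloc : IsLocalMin (fun x => g x - η * ‖x - x₁‖ ^ 2) x₂ :=
    hmin.isLocalMin (mem_of_superset (hV.mem_nhds (hLV hx₂L)) subset_closure)
  have h1 := classicalLaplacian_nonneg_of_isLocalMin hG hloc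
  rw [classicalLaplacian_sub hg hηq] at h1
  have h2 := hgΔ x₂ ((closedBall_subset_cthickening hx₂L δ).trans hδV)
  have h3 : classicalLaplacian (fun x : Space d => η * ‖x - x₁‖ ^ 2) x₂ = η * (2 * d) := by
    rw [classicalLaplacian_const_mul hq, classicalLaplacian_norm_sub_sq]
  have : (0 : ℝ) < d := by exact_mod_cast hd
  have : 0 < η * (2 * d) := by positivity
  linarith

/-- **Weak minimum principle.** A function that is continuous up to the boundary of a bounded open
set, non-negative on the boundary, and weakly superharmonic where it is negative, is
non-negative. -/
theorem nonneg_of_isWeaklySuperharmonic (hd : 1 ≤ d) {V : Set (Space d)}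
    (hV : IsOpen V) (hVb : Bornology.IsBounded V) {W : Space d → ℝ}
    (hW : ContinuousOn W (closure V)) (hbd : ∀ x ∈ frontier V, 0 ≤ W x)
    (hsup : IsWeaklySuperharmonic {x ∈ V | W x < 0} W) :
    ∀ x ∈ V, 0 ≤ W x := by
  -- extend `W` continuously to the whole space
  obtain ⟨W', hW'⟩ := ContinuousMap.exists_restrict_eq isClosed_closure
    (⟨_, hW.domRestrict⟩ : C(closure V, ℝ))
  have heq : ∀ x ∈ closure V, W' x = W x := fun x hx =>
    DFunLike.congr_fun hW' (⟨x, hx⟩ : closure V)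
  set N : Set (Space d) := {x ∈ V | W x < 0}
  have hN : N = V ∩ {x | W' x < 0} := by
    ext x
    exact and_congr_right fun hx => by rw [mem_ofPred_eq, heq x (subset_closure hx)]
  have hNo : IsOpen N := hN ▸ hV.inter (isOpen_lt W'.continuous continuous_const)
  have hNV : N ⊆ V := fun x hx => hx.1
  intro x hx
  by_contra! hneg
  have h := nonneg_of_isWeaklySuperharmonic_of_continuous hd hNo (hVb.subset hNV) W'.continuous
    (fun y hy => ?_) (hsup.congr fun y hy => (heq y (subset_closure hy.1)).symm) x ⟨hx, hneg⟩
  · rw [heq x (subset_closure hx)] at h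
    exact absurd h (not_le.2 hneg)
  · rw [hNo.frontier_eq] at hy
    have hyV : y ∈ closure V := closure_mono hNV hy.1
    rw [heq y hyV]
    by_cases hyV' : y ∈ V
    · by_contra! h'
      exact hy.2 ⟨hyV', h'⟩
    · exact hbd y (by rw [hV.frontier_eq]; exact ⟨hyV, hyV'⟩)

end MaximumPrinciple

/-! ### Weak and classical Laplacians -/

section WeakLaplacian

variable {d : ℕ} {Ω : C2Domain d}

theorem weakDeriv_sub (u v : H2 Ω) {l : List (Fin d)} (hl : l.length ≤ 2) :
    weakDeriv l ((u - v : H2 Ω) : L2 Ω) = weakDeriv l (u : L2 Ω) - weakDeriv l (v : L2 Ω) := by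
  have h := (hasWeakDeriv_weakDeriv u hl).add ((hasWeakDeriv_weakDeriv v hl).smul (-1))
  have e : ∀ a b : L2 Ω, a + (-1 : ℝ) • b = a - b := fun a b => by
    rw [neg_one_smul, sub_eq_add_neg]
  rw [e, e] at h
  exact (hasWeakDeriv_weakDeriv (u - v) hl).unique h

theorem laplacian_sub (u v : H2 Ω) : laplacian (u - v) = laplacian u - laplacian v := by
  simp only [laplacian, ← Finset.sum_sub_distrib]
  exact Finset.sum_congr rfl fun i _ => weakDeriv_sub u v (by simp)

theorem IsNonnegTest.isTestFunction {V : Set (Space d)} {φ : Space d → ℝ} (hφ : IsNonnegTest V φ)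
    (hV : V ⊆ Ω.carrier) : IsTestFunction Ω φ :=
  ⟨hφ.contDiff, hφ.hasCompactSupport, hφ.tsupport_subset.trans hV⟩

/-- The weak Laplacian is the distributional Laplacian. -/
theorem integral_mul_classicalLaplacian (u : H2 Ω) {φ : Space d → ℝ} (hφ : IsTestFunction Ω φ) :
    ∫ x, (u : L2 Ω) x * classicalLaplacian φ x ∂Ω.vol = ∫ x, φ x * laplacian u x ∂Ω.vol := by
  have h1 : ∀ i : Fin d, ∫ x, partialDeriv [i, i] φ x • (u : L2 Ω) x ∂Ω.vol
      = ∫ x, φ x • weakDeriv [i, i] (u : L2 Ω) x ∂Ω.vol := fun i => by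
    have := hasWeakDeriv_weakDeriv u (l := [i, i]) (by simp) φ hφ
    simpa using this
  have h2 : ∫ x, φ x * laplacian u x ∂Ω.vol
      = ∫ x, ∑ i, φ x • weakDeriv [i, i] (u : L2 Ω) x ∂Ω.vol := by
    refine integral_congr_ae ?_
    filter_upwards [Lp.coeFn_finsetSum Finset.univ
      fun i : Fin d => weakDeriv [i, i] (u : L2 Ω)] with x hx
    rw [laplacian, hx, Finset.sum_apply, Finset.mul_sum]
    rfl
  rw [h2, integral_finsetSum _ fun i _ => integrable_test_smul Ω hφ _]
  simp only [classicalLaplacian, Finset.mul_sum, ← h1]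
  rw [← integral_finsetSum _ fun i _ => integrable_partialDeriv_smul Ω hφ _ _]
  simp only [smul_eq_mul, mul_comm]

/-- Green's second identity for a smooth function and a test function. -/
theorem integral_mul_classicalLaplacian_comm {ψ φ : Space d → ℝ} (hψ : ContDiff ℝ ∞ ψ)
    (hφ : ContDiff ℝ ∞ φ) (hφc : HasCompactSupport φ) :
    ∫ x, ψ x * classicalLaplacian φ x = ∫ x, φ x * classicalLaplacian ψ x := by
  have hI : ∀ {a b : Space d → ℝ}, ContDiff ℝ ∞ a → ContDiff ℝ ∞ b → HasCompactSupport b →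
      Integrable (fun x => a x * b x) := fun ha hb hbc =>
    (ha.continuous.mul hb.continuous).integrable_of_hasCompactSupport hbc.mul_left
  -- one integration by parts
  have hP : ∀ {a b : Space d → ℝ} (i : Fin d), ContDiff ℝ ∞ a → ContDiff ℝ ∞ b →
      HasCompactSupport b →
      ∫ x, a x * partialDeriv [i] b x = - ∫ x, partialDeriv [i] a x * b x := fun i ha hb hbc =>
    integral_mul_fderiv_eq_neg_fderiv_mul_of_integrable
      (hI (ha.partialDeriv [i]) hb hbc) (hI ha (hb.partialDeriv [i]) (hbc.partialDeriv [i]))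
      (hI ha hb hbc) (fun x _ => ha.differentiable (by simp) x)
      (fun x _ => hb.differentiable (by simp) x)
  simp only [classicalLaplacian, Finset.mul_sum]
  rw [integral_finsetSum _ fun i _ => hI hψ (hφ.partialDeriv _) (hφc.partialDeriv _),
    integral_finsetSum _ fun i _ => by
      simpa only [mul_comm] using hI (hψ.partialDeriv [i, i]) hφ hφc]
  refine Finset.sum_congr rfl fun i _ => ?_
  have h1 := hP i hψ (hφ.partialDeriv [i]) (hφc.partialDeriv [i])
  have h2 := hP i (hψ.partialDeriv [i]) hφ hφc
  rw [h2, neg_neg] at h1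
  exact h1.trans (by simp only [mul_comm]; rfl)

/-- If `Δu ≤ Δψ` almost everywhere on `V`, then `U - ψ` is weakly superharmonic on `V`, for every
representative `U` of `u`. -/
theorem isWeaklySuperharmonic_sub {u : H2 Ω} {U : Space d → ℝ}
    (hU : U =ᵐ[Ω.vol] ((u : L2 Ω) : Space d → ℝ)) {ψ : Space d → ℝ} (hψ : ContDiff ℝ ∞ ψ)
    {V : Set (Space d)} (hV : V ⊆ Ω.carrier)
    (hle : ∀ᵐ x ∂Ω.vol, x ∈ V → laplacian u x ≤ classicalLaplacian ψ x) :
    IsWeaklySuperharmonic V fun x => U x - ψ x := by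
  intro φ hφ
  have hφΩ : IsTestFunction Ω φ := hφ.isTestFunction hV
  have hzero : ∀ x ∉ Ω.carrier, φ x = 0 := fun x hx =>
    image_eq_zero_of_notMem_tsupport fun h => hx (hφΩ.tsupport_subset h)
  have hzero' : ∀ x ∉ Ω.carrier, classicalLaplacian φ x = 0 := fun x hx =>
    image_eq_zero_of_notMem_tsupport fun h =>
      hx (hφΩ.tsupport_subset (tsupport_classicalLaplacian_subset φ h))
  have hL := contDiff_classicalLaplacian hφ.contDiff
  have hLc := hasCompactSupport_classicalLaplacian hφ.hasCompactSupport
  have hi1 : Integrable (fun x => U x * classicalLaplacian φ x) Ω.vol := by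
    have hu : Integrable ((u : L2 Ω) : Space d → ℝ) Ω.vol :=
      (Lp.memLp (u : L2 Ω)).integrable (by norm_num)
    obtain ⟨C, hC⟩ := hLc.exists_bound_of_continuous hL.continuous
    exact (hu.congr hU.symm).mul_bdd hL.continuous.aestronglyMeasurable
      (Eventually.of_forall hC)
  have hi2 : Integrable (fun x => ψ x * classicalLaplacian φ x) Ω.vol :=
    ((hψ.continuous.mul hL.continuous).integrable_of_hasCompactSupport hLc.mul_left).restrict
  have hi3 : Integrable (fun x => φ x * classicalLaplacian ψ x) Ω.vol :=
    ((hφ.contDiff.continuous.mul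
      (contDiff_classicalLaplacian hψ).continuous).integrable_of_hasCompactSupport
        hφ.hasCompactSupport.mul_right).restrict
  have e1 : ∫ x, (U x - ψ x) * classicalLaplacian φ x
      = ∫ x, (U x * classicalLaplacian φ x - ψ x * classicalLaplacian φ x) ∂Ω.vol := by
    rw [setIntegral_eq_integral_of_forall_compl_eq_zero]
    · simp only [sub_mul]
    · intro x hx
      simp [hzero' x hx]
  have e2 : ∫ x, U x * classicalLaplacian φ x ∂Ω.vol = ∫ x, φ x * laplacian u x ∂Ω.vol := by
    rw [← integral_mul_classicalLaplacian u hφΩ]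
    refine integral_congr_ae ?_
    filter_upwards [hU] with x hx
    rw [hx]
  have e3 : ∫ x, ψ x * classicalLaplacian φ x ∂Ω.vol
      = ∫ x, φ x * classicalLaplacian ψ x ∂Ω.vol := by
    rw [setIntegral_eq_integral_of_forall_compl_eq_zero fun x hx => by simp [hzero' x hx],
      setIntegral_eq_integral_of_forall_compl_eq_zero fun x hx => by simp [hzero x hx],
      integral_mul_classicalLaplacian_comm hψ hφ.contDiff hφ.hasCompactSupport]
  rw [e1, integral_sub hi1 hi2, e2, e3, sub_nonpos]
  refine integral_mono_ae (integrable_test_smul Ω hφΩ (laplacian u)) hi3 ?_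
  filter_upwards [hle] with x hx
  by_cases hxV : x ∈ V
  · exact mul_le_mul_of_nonneg_left (hx hxV) (hφ.nonneg x)
  · have : φ x = 0 := image_eq_zero_of_notMem_tsupport fun h => hxV (hφ.tsupport_subset h)
    simp [this]

end WeakLaplacian

/-! ### Uniqueness for the Poisson problem -/

section Poisson

variable {d : ℕ} {Ω : C2Domain d}

/-- A function of `H²(Ω)` with vanishing trace and weak Laplacian `0` has non-negative continuous
representative. -/
theorem nonneg_of_laplacian_eq_zero (hd : 1 ≤ d) {u : H2 Ω} (hΔ : laplacian u = 0)
    {U : Space d → ℝ} (hUc : ContinuousOn U (closure Ω.carrier))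
    (hU : U =ᵐ[Ω.vol] ((u : L2 Ω) : Space d → ℝ)) (hU0 : ∀ x ∈ frontier Ω.carrier, U x = 0) :
    ∀ x ∈ Ω.carrier, 0 ≤ U x := by
  refine nonneg_of_isWeaklySuperharmonic hd Ω.isOpen Ω.isBounded hUc (fun x hx => (hU0 x hx).ge) ?_
  have h := isWeaklySuperharmonic_sub (V := {x ∈ Ω.carrier | U x < 0}) hU
    (contDiff_const (c := (0 : ℝ))) (fun x hx => hx.1) ?_
  · simpa using h
  · rw [hΔ]
    filter_upwards [Lp.coeFn_zero ℝ 2 Ω.vol] with x hx _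
    rw [hx]
    simp [classicalLaplacian, partialDeriv]

theorem eq_of_laplacian_eq_of_hasTrace (hd : 1 ≤ d) {u v : H2 Ω} {f : Space d → ℝ}
    (hΔ : laplacian u = laplacian v) (hu : HasTrace u f) (hv : HasTrace v f) : u = v := by
  obtain ⟨U, hUc, hU, hUf⟩ := hu
  obtain ⟨V, hVc, hV, hVf⟩ := hv
  have hsub : ∀ {a b : H2 Ω} {A B : Space d → ℝ}, A =ᵐ[Ω.vol] ((a : L2 Ω) : Space d → ℝ) →
      B =ᵐ[Ω.vol] ((b : L2 Ω) : Space d → ℝ) →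
      (fun x => A x - B x) =ᵐ[Ω.vol] (((a - b : H2 Ω) : L2 Ω) : Space d → ℝ) := by
    intro a b A B hA hB
    filter_upwards [hA, hB, Lp.coeFn_sub (a : L2 Ω) (b : L2 Ω)] with x h1 h2 h3
    rw [h1, h2]
    exact h3.symm
  have h1 := nonneg_of_laplacian_eq_zero hd (u := u - v) (by rw [laplacian_sub, hΔ, sub_self])
    (hUc.sub hVc) (hsub hU hV) (fun x hx => by simp [hUf x hx, hVf x hx])
  have h2 := nonneg_of_laplacian_eq_zero hd (u := v - u) (by rw [laplacian_sub, hΔ, sub_self])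
    (hVc.sub hUc) (hsub hV hU) (fun x hx => by simp [hUf x hx, hVf x hx])
  refine Subtype.ext (Lp.ext ?_)
  filter_upwards [hU, hV, ae_restrict_mem Ω.isOpen.measurableSet] with x hx1 hx2 hx
  rw [← hx1, ← hx2]
  have a := h1 x hx
  have b := h2 x hx
  simp only [Pi.sub_apply] at a b
  linarith

theorem poissonSolution_eq (hd : 1 ≤ d) {u : H2 Ω} {g : L2 Ω} {f : Space d → ℝ}
    (hΔ : laplacian u = g) (hu : HasTrace u f) : poissonSolution g f = u := by
  have h : ∃ u : H2 Ω, laplacian u = g ∧ HasTrace u f := ⟨u, hΔ, hu⟩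
  rw [poissonSolution, dif_pos h]
  exact eq_of_laplacian_eq_of_hasTrace hd (h.choose_spec.1.trans hΔ.symm) h.choose_spec.2 hu

end Poisson

/-! ### The strong maximum principle -/

section Positivity

variable {d : ℕ} {Ω : C2Domain d}

theorem contDiff_exp_neg_norm_sub_sq (x₀ : Space d) (α : ℝ) :
    ContDiff ℝ ∞ fun y : Space d => Real.exp (-α * ‖y - x₀‖ ^ 2) :=
  (contDiff_const.mul ((contDiff_id.sub contDiff_const).norm_sq ℝ)).exp

theorem classicalLaplacian_exp_neg_norm_sub_sq (x₀ x : Space d) (α : ℝ) :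
    classicalLaplacian (fun y : Space d => Real.exp (-α * ‖y - x₀‖ ^ 2)) x
      = (4 * α ^ 2 * ‖x - x₀‖ ^ 2 - 2 * α * d) * Real.exp (-α * ‖x - x₀‖ ^ 2) := by
  have hE : ∀ y : Space d, HasFDerivAt (fun y : Space d => Real.exp (-α * ‖y - x₀‖ ^ 2))
      (Real.exp (-α * ‖y - x₀‖ ^ 2) • ((-α) • (2 • innerSL ℝ (y - x₀)))) y := fun y =>
    ((hasFDerivAt_norm_sub_sq x₀ y).const_mul (-α)).exp
  have h1 : ∀ i : Fin d, partialDeriv [i] (fun y : Space d => Real.exp (-α * ‖y - x₀‖ ^ 2))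
      = fun y => (-2 * α) * (y i - x₀ i) * Real.exp (-α * ‖y - x₀‖ ^ 2) := fun i => by
    funext y
    simp only [partialDeriv, (hE y).fderiv]
    simp [innerSL_apply_apply, EuclideanSpace.inner_single_right]
    ring
  have h2 : ∀ i : Fin d, partialDeriv [i, i] (fun y : Space d => Real.exp (-α * ‖y - x₀‖ ^ 2)) x
      = (4 * α ^ 2 * (x i - x₀ i) ^ 2 - 2 * α) * Real.exp (-α * ‖x - x₀‖ ^ 2) := fun i => by
    change fderiv ℝ (partialDeriv [i] _) x _ = _
    rw [h1]
    have h := (hasFDerivAt_coord_sub x₀ x i (-2 * α)).fun_mul (hE x)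
    rw [h.fderiv]
    simp [innerSL_apply_apply, EuclideanSpace.inner_single_right]
    ring
  have h3 : ‖x - x₀‖ ^ 2 = ∑ i, (x i - x₀ i) ^ 2 := by
    simp [EuclideanSpace.real_norm_sq_eq]
  rw [classicalLaplacian, Finset.sum_congr rfl fun i _ => h2 i, ← Finset.sum_mul, h3,
    Finset.sum_sub_distrib, ← Finset.mul_sum]
  simp
  ring_nf

/-- Positivity spreads from a ball to every concentric ball inside `Ω`: on the annulus between them
compare with the barrier `exp (-α |x - x₀|²) - exp (-α R²)`, whose Laplacian dominates `M` times
itself for large `α`. -/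
theorem pos_on_ball_of_pos_on_closedBall (hd : 1 ≤ d) {u : H2 Ω} {U : Space d → ℝ}
    (hUc : ContinuousOn U Ω.carrier) (hU : U =ᵐ[Ω.vol] ((u : L2 Ω) : Space d → ℝ))
    (hU0 : ∀ x ∈ Ω.carrier, 0 ≤ U x) {M : ℝ} (hM : 0 ≤ M)
    (hle : ∀ᵐ x ∂Ω.vol, laplacian u x ≤ M * U x) {x₀ : Space d} {r R : ℝ} (hr : 0 < r)
    (hR : closedBall x₀ R ⊆ Ω.carrier) (hrR : r < R) (hpos : ∀ x ∈ closedBall x₀ r, 0 < U x) :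
    ∀ x ∈ ball x₀ R, 0 < U x := by
  intro x hx
  by_cases hxr : x ∈ closedBall x₀ r
  · exact hpos x hxr
  have hrR' : closedBall x₀ r ⊆ Ω.carrier := (closedBall_subset_closedBall hrR.le).trans hR
  obtain ⟨y, hy, hymin⟩ := (isCompact_closedBall x₀ r).exists_isMinOn ⟨x₀, by simp [hr.le]⟩
    (hUc.mono hrR')
  set c : ℝ := U y
  have hc : 0 < c := hpos y hy
  -- `α ≥ 1` and `4 α r² ≥ 2 d + M` give `4 α² r² - 2 α d ≥ M`
  obtain ⟨α, hα1, hα⟩ : ∃ α : ℝ, 1 ≤ α ∧ 2 * d + M ≤ 4 * α * r ^ 2 := by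
    refine ⟨max 1 ((2 * d + M) / (4 * r ^ 2)), le_max_left _ _, ?_⟩
    have h := le_max_right 1 ((2 * d + M) / (4 * r ^ 2))
    rw [div_le_iff₀ (by positivity)] at h
    linarith
  set E : Space d → ℝ := fun y => Real.exp (-α * ‖y - x₀‖ ^ 2)
  set k : ℝ := Real.exp (-α * R ^ 2)
  have hE : ContDiff ℝ ∞ E := contDiff_exp_neg_norm_sub_sq x₀ α
  have hEk : ContDiff ℝ ∞ fun y => E y - k := hE.sub contDiff_const
  have hψ : ContDiff ℝ ∞ fun y => c * (E y - k) := contDiff_const.mul hEk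
  have hΔ : ∀ z, r < ‖z - x₀‖ →
      M * (c * (E z - k)) ≤ classicalLaplacian (fun y => c * (E y - k)) z := by
    intro z hz
    rw [classicalLaplacian_const_mul hEk, classicalLaplacian_sub hE contDiff_const,
      classicalLaplacian_exp_neg_norm_sub_sq]
    have h0 : classicalLaplacian (fun _ : Space d => k) z = 0 := by
      simp [classicalLaplacian, partialDeriv]
    have hz2 : r ^ 2 ≤ ‖z - x₀‖ ^ 2 := by gcongr
    have hcoef : M ≤ 4 * α ^ 2 * ‖z - x₀‖ ^ 2 - 2 * α * d := by
      have e1 : α * (2 * d + M) ≤ α * (4 * α * r ^ 2) := by gcongr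
      have e2 : M ≤ α * M := le_mul_of_one_le_left hM hα1
      have e3 : 4 * α ^ 2 * r ^ 2 ≤ 4 * α ^ 2 * ‖z - x₀‖ ^ 2 := by gcongr
      linarith
    have hEz : 0 ≤ E z := (Real.exp_pos _).le
    have hk : 0 ≤ k := (Real.exp_pos _).le
    rw [h0, sub_zero, mul_left_comm]
    refine mul_le_mul_of_nonneg_left ?_ hc.le
    calc M * (E z - k) ≤ M * E z := by gcongr; linarith
      _ ≤ _ := by gcongr
  set A : Set (Space d) := ball x₀ R \ closedBall x₀ r
  have hA : IsOpen A := isOpen_ball.sdiff isClosed_closedBall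
  have hAcl : closure A ⊆ closedBall x₀ R :=
    closure_minimal (fun z hz => ball_subset_closedBall hz.1) isClosed_closedBall
  have hAΩ : A ⊆ Ω.carrier := (subset_closure.trans hAcl).trans hR
  have hW := nonneg_of_isWeaklySuperharmonic (W := fun z => U z - c * (E z - k)) hd hA
    (isBounded_ball.subset sdiff_subset)
    ((hUc.mono (hAcl.trans hR)).sub hψ.continuous.continuousOn) ?_ ?_ x ⟨hx, hxr⟩
  · have h : k < E x := by
      refine Real.exp_lt_exp.2 ?_
      have : ‖x - x₀‖ < R := by simpa [dist_eq_norm] using hx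
      have : ‖x - x₀‖ ^ 2 < R ^ 2 := by gcongr
      nlinarith
    have : 0 < c * (E x - k) := mul_pos hc (sub_pos.2 h)
    linarith
  · intro z hz
    rw [hA.frontier_eq] at hz
    have hzR := hAcl hz.1
    by_cases hzr : z ∈ closedBall x₀ r
    · have h1 : c ≤ U z := isMinOn_iff.1 hymin z hzr
      have h2 : E z ≤ 1 := Real.exp_le_one_iff.2 (by
        have : 0 ≤ α * ‖z - x₀‖ ^ 2 := by positivity
        linarith)
      have h3 : 0 < k := Real.exp_pos _
      have h4 : c * (E z - k) ≤ c * 1 := by gcongr; linarith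
      linarith
    · have h1 : ‖z - x₀‖ = R := by
        refine le_antisymm (by simpa [dist_eq_norm] using hzR) ?_
        by_contra! h
        exact hz.2 ⟨by simpa [dist_eq_norm] using h, hzr⟩
      have h2 : E z = k := by simp only [E, k, h1]
      rw [h2, sub_self, mul_zero, sub_zero]
      exact hU0 z (hR hzR)
  · refine isWeaklySuperharmonic_sub hU hψ (fun z hz => hAΩ hz.1) ?_
    filter_upwards [hle] with z hz hzA
    refine hz.trans (le_trans ?_ (hΔ z ?_))
    · exact mul_le_mul_of_nonneg_left (by linarith [hzA.2]) hM
    · simpa [dist_eq_norm] using hzA.1.2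

theorem C2Domain.frontier_nonempty (hd : 1 ≤ d) (Ω : C2Domain d) :
    (frontier Ω.carrier).Nonempty := by
  have : Nonempty (Fin d) := ⟨⟨0, hd⟩⟩
  refine nonempty_frontier_iff.2 ⟨Ω.isConnected.nonempty, fun h => ?_⟩
  exact NormedSpace.unbounded_univ ℝ (Space d) (h ▸ Ω.isBounded)

/-- A strong solution of `-Δu + q u = 0` with `0 ≤ q ∈ L^∞(Ω)` and positive boundary values is
positive in `Ω`. -/
theorem IsStrongSolution.exists_pos_representative (hd : 1 ≤ d) {q : L2 Ω}
    (hq_bdd : MemLp q ⊤ Ω.vol) (hq_nonneg : ∀ᵐ x ∂Ω.vol, 0 ≤ q x) {f : Space d → ℝ}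
    (hf : ∀ x ∈ frontier Ω.carrier, 0 < f x) {u : H2 Ω} (hu : IsStrongSolution q f u) :
    ∃ U : Space d → ℝ, ContinuousOn U (closure Ω.carrier) ∧
      U =ᵐ[Ω.vol] ((u : L2 Ω) : Space d → ℝ) ∧ ∀ x ∈ Ω.carrier, 0 < U x := by
  obtain ⟨heq, U, hUc, hU, hUf⟩ := hu
  refine ⟨U, hUc, hU, ?_⟩
  have hΔ : ∀ᵐ x ∂Ω.vol, laplacian u x = q x * U x := by
    filter_upwards [heq, hU] with x h1 h2
    rw [h2]
    linarith
  have hUΩ : ContinuousOn U Ω.carrier := hUc.mono subset_closure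
  -- where `U` is negative, `Δu = q u ≤ 0`
  have hU0 : ∀ x ∈ Ω.carrier, 0 ≤ U x := by
    refine nonneg_of_isWeaklySuperharmonic hd Ω.isOpen Ω.isBounded hUc
      (fun x hx => (hUf x hx).symm ▸ (hf x hx).le) ?_
    have h := isWeaklySuperharmonic_sub (V := {x ∈ Ω.carrier | U x < 0}) hU
      (contDiff_const (c := (0 : ℝ))) (fun x hx => hx.1) ?_
    · simpa using h
    · filter_upwards [hΔ, hq_nonneg] with x h1 h2 h3
      have : q x * U x ≤ 0 := mul_nonpos_of_nonneg_of_nonpos h2 h3.2.le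
      rw [h1]
      simpa [classicalLaplacian, partialDeriv] using this
  obtain ⟨M, hM, hle⟩ : ∃ M : ℝ, 0 ≤ M ∧ ∀ᵐ x ∂Ω.vol, laplacian u x ≤ M * U x := by
    refine ⟨(eLpNorm q ⊤ Ω.vol).toReal, ENNReal.toReal_nonneg, ?_⟩
    filter_upwards [hΔ, ae_le_eLpNormEssSup (f := q) (μ := Ω.vol),
      ae_restrict_mem Ω.isOpen.measurableSet] with x h1 h2 hx
    rw [h1]
    refine mul_le_mul_of_nonneg_right ?_ (hU0 x hx)
    rw [← eLpNorm_exponent_top] at h2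
    have h3 := ENNReal.toReal_mono hq_bdd.2.ne h2
    rw [toReal_enorm] at h3
    exact (le_abs_self _).trans h3
  set P : Set (Space d) := Ω.carrier ∩ U ⁻¹' Ioi 0
  have hP : IsOpen P := hUΩ.isOpen_inter_preimage Ω.isOpen isOpen_Ioi
  have hne : (Ω.carrier ∩ P).Nonempty := by
    obtain ⟨x, hx⟩ := C2Domain.frontier_nonempty hd Ω
    have hxc : x ∈ closure Ω.carrier := frontier_subset_closure hx
    have hlim : Tendsto U (𝓝[Ω.carrier] x) (𝓝 (U x)) := (hUc x hxc).mono subset_closure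
    have : (𝓝[Ω.carrier] x).NeBot := mem_closure_iff_nhdsWithin_neBot.1 hxc
    have h0 : 0 < U x := (hUf x hx).symm ▸ hf x hx
    obtain ⟨y, hy1, hy2⟩ := ((hlim.eventually (lt_mem_nhds h0)).and self_mem_nhdsWithin).exists
    exact ⟨y, hy2, hy2, hy1⟩
  have hcl : closure P ∩ Ω.carrier ⊆ P := by
    rintro y ⟨hyP, hy⟩
    obtain ⟨s, hs, hsΩ⟩ := Metric.isOpen_iff.1 Ω.isOpen y hy
    obtain ⟨x₀, hx₀, hyx⟩ := Metric.mem_closure_iff.1 hyP (s / 3) (by positivity)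
    obtain ⟨r, hr, hrP⟩ := Metric.nhds_basis_closedBall.mem_iff.1 (hP.mem_nhds hx₀)
    have hr' : closedBall x₀ (min r (s / 3)) ⊆ P :=
      (closedBall_subset_closedBall (min_le_left _ _)).trans hrP
    refine ⟨hy, pos_on_ball_of_pos_on_closedBall hd hUΩ hU hU0 hM hle
      (r := min r (s / 3)) (R := s / 2) (lt_min hr (by positivity)) (fun z hz => hsΩ ?_)
      ((min_le_right _ _).trans_lt (by linarith)) (fun z hz => (hr' hz).2) y ?_⟩
    · rw [mem_closedBall] at hz
      rw [mem_ball]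
      linarith [dist_triangle z x₀ y, dist_comm y x₀]
    · rw [mem_ball]
      linarith
  exact fun x hx =>
    (Ω.isConnected.isPreconnected.subset_of_closure_inter_subset hP hne hcl hx).2

end Positivity

/-! ### Elementary tensors and the Hilbert–Schmidt operator -/

section Tensors

variable {d : ℕ} {Ω : C2Domain d}

theorem weakDeriv_map {V W : Type*} [NormedAddCommGroup V] [NormedSpace ℝ V] [CompleteSpace V]
    [NormedAddCommGroup W] [NormedSpace ℝ W] [CompleteSpace W] (T : V →L[ℝ] W) (F : H2V Ω V)
    {l : List (Fin d)} (hl : l.length ≤ 2) :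
    weakDeriv l (H2V.map T F : L2V Ω W) = T.compLp (weakDeriv l (F : L2V Ω V)) :=
  (hasWeakDeriv_weakDeriv (H2V.map T F) hl).unique ((hasWeakDeriv_weakDeriv F hl).map T)

theorem weakDeriv_nil (u : H2 Ω) : weakDeriv [] (u : L2 Ω) = u :=
  (hasWeakDeriv_weakDeriv u (l := []) (by simp)).unique fun φ _ => by simp [partialDeriv]

theorem coeFn_map {V W : Type*} [NormedAddCommGroup V] [NormedSpace ℝ V] [CompleteSpace V]
    [NormedAddCommGroup W] [NormedSpace ℝ W] [CompleteSpace W] (T : V →L[ℝ] W) (F : H2V Ω V) :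
    ((H2V.map T F : L2V Ω W) : Space d → W) =ᵐ[Ω.vol] fun x => T ((F : L2V Ω V) x) :=
  T.coeFn_compLp (F : L2V Ω V)

theorem coeFn_tensor (w : H2 Ω) (p : L2 Ω) :
    ((tensor w p : L2V Ω (L2 Ω)) : Space d → L2 Ω) =ᵐ[Ω.vol] fun x => (w : L2 Ω) x • p := by
  simpa [tensor, ContinuousLinearMap.toSpanSingleton_apply] using
    coeFn_map (ContinuousLinearMap.toSpanSingleton ℝ p) w

theorem map_integralL2_tensor (w : H2 Ω) (p : L2 Ω) :
    H2V.map integralL2 (tensor w p) = (∫ y, p y ∂Ω.vol) • w := by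
  refine Subtype.ext (Lp.ext ?_)
  filter_upwards [coeFn_map integralL2 (tensor w p), coeFn_tensor w p,
    Lp.coeFn_smul (∫ y, p y ∂Ω.vol) (w : L2 Ω)] with x h1 h2 h3
  rw [h1, h2, map_smul]
  refine Eq.trans ?_ h3.symm
  rw [Pi.smul_apply, smul_eq_mul, smul_eq_mul, mul_comm]
  rfl

theorem smul_tensor (c : ℝ) (w : H2 Ω) (p : L2 Ω) : tensor (c • w) p = tensor w (c • p) := by
  refine Subtype.ext (Lp.ext ?_)
  filter_upwards [coeFn_tensor (c • w) p, coeFn_tensor w (c • p),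
    Lp.coeFn_smul c (w : L2 Ω)] with x h1 h2 h3
  have h4 : ((c • w : H2 Ω) : L2 Ω) x = c * (w : L2 Ω) x := h3
  rw [h1, h2, h4, smul_smul, mul_comm]

/-- The inner product `⟨a, b⟩_{H²(Ω)} = ∑_{|α| ≤ 2} ∫_Ω D^α a D^α b`. -/
noncomputable def sobolevInner (a b : H2 Ω) : ℝ :=
  ∫ x, weakDeriv [] (a : L2 Ω) x * weakDeriv [] (b : L2 Ω) x ∂Ω.vol
    + ∑ i : Fin d, ∫ x, weakDeriv [i] (a : L2 Ω) x * weakDeriv [i] (b : L2 Ω) x ∂Ω.vol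
    + ∑ i : Fin d, ∑ j ∈ Finset.Ici i,
        ∫ x, weakDeriv [i, j] (a : L2 Ω) x * weakDeriv [i, j] (b : L2 Ω) x ∂Ω.vol

theorem norm_sq_le_sobolevInner_self (a : H2 Ω) : ‖(a : L2 Ω)‖ ^ 2 ≤ sobolevInner a a := by
  have h0 : ∀ l : List (Fin d),
      0 ≤ ∫ x, weakDeriv l (a : L2 Ω) x * weakDeriv l (a : L2 Ω) x ∂Ω.vol := fun l =>
    integral_nonneg fun x => mul_self_nonneg _
  have h1 : ‖(a : L2 Ω)‖ ^ 2
      = ∫ x, weakDeriv [] (a : L2 Ω) x * weakDeriv [] (a : L2 Ω) x ∂Ω.vol := by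
    rw [weakDeriv_nil, ← real_inner_self_eq_norm_sq, L2.inner_def]
    rfl
  rw [h1, sobolevInner, add_assoc]
  exact le_add_of_nonneg_right (add_nonneg (Finset.sum_nonneg fun i _ => h0 _)
    (Finset.sum_nonneg fun i _ => Finset.sum_nonneg fun j _ => h0 _))

theorem inner_pairing (F : H2V Ω (L2 Ω)) (r : L2 Ω) {l : List (Fin d)} (hl : l.length ≤ 2)
    (a : H2 Ω) : inner ℝ r (pairing F l a)
      = ∫ x, weakDeriv l (a : L2 Ω) x
          * weakDeriv l ((H2V.map (innerSL ℝ r) F : H2 Ω) : L2 Ω) x ∂Ω.vol := by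
  rw [weakDeriv_map _ _ hl, pairing, ← innerSL_apply_apply ℝ,
    ← ContinuousLinearMap.integral_comp_comm _ (integrable_pairing _ _)]
  refine integral_congr_ae ?_
  filter_upwards [(innerSL ℝ r).coeFn_compLp (weakDeriv l (F : L2V Ω (L2 Ω)))] with x hx
  rw [hx, map_smul, smul_eq_mul]

/-- The adjoint of the Hilbert–Schmidt operator of `F` sends `r` to the slice `x ↦ ⟨r, F x⟩`. -/
theorem inner_hsOperator (F : H2V Ω (L2 Ω)) (r : L2 Ω) (a : H2 Ω) :
    inner ℝ r (hsOperator F a) = sobolevInner a (H2V.map (innerSL ℝ r) F) := by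
  change inner ℝ r (_ + _ + _) = _
  simp only [inner_add_right, inner_sum, sobolevInner]
  congr 1
  · congr 1
    · exact inner_pairing F r (by simp) a
    · exact Finset.sum_congr rfl fun i _ => inner_pairing F r (by simp) a
  · exact Finset.sum_congr rfl fun i _ => Finset.sum_congr rfl fun j _ =>
      inner_pairing F r (by simp) a

theorem pairing_tensor (w : H2 Ω) (p : L2 Ω) {l : List (Fin d)} (hl : l.length ≤ 2) (a : H2 Ω) :
    pairing (tensor w p) l a
      = (∫ x, weakDeriv l (a : L2 Ω) x * weakDeriv l (w : L2 Ω) x ∂Ω.vol) • p := by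
  rw [pairing, ← integral_smul_const]
  refine integral_congr_ae ?_
  rw [tensor, weakDeriv_map _ _ hl]
  filter_upwards [(ContinuousLinearMap.toSpanSingleton ℝ p).coeFn_compLp
    (weakDeriv l (w : L2 Ω))] with x hx
  rw [hx, ContinuousLinearMap.toSpanSingleton_apply, smul_smul]

theorem hsOperator_tensor (w : H2 Ω) (p : L2 Ω) (a : H2 Ω) :
    hsOperator (tensor w p) a = sobolevInner a w • p := by
  change (pairing _ _ _ + ∑ _, pairing _ _ _ + ∑ _, ∑ _ ∈ _, pairing _ _ _ : L2 Ω) = _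
  simp only [sobolevInner, add_smul, Finset.sum_smul]
  congr 1
  · congr 1
    · exact pairing_tensor w p (by simp) a
    · exact Finset.sum_congr rfl fun i _ => pairing_tensor w p (by simp) a
  · exact Finset.sum_congr rfl fun i _ => Finset.sum_congr rfl fun j _ =>
      pairing_tensor w p (by simp) a

theorem linearMap_rank_eq_one_iff {V W : Type*} [AddCommGroup V] [Module ℝ V] [AddCommGroup W]
    [Module ℝ W] {T : V →ₗ[ℝ] W} :
    LinearMap.rank T = 1 ↔ ∃ v, T v ≠ 0 ∧ ∀ a, ∃ c : ℝ, c • T v = T a := by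
  rw [LinearMap.rank, rank_submodule_eq_one_iff]
  constructor
  · rintro ⟨_, ⟨v, rfl⟩, hv, h⟩
    exact ⟨v, hv, fun a => Submodule.mem_span_singleton.1 (h (LinearMap.mem_range_self _ a))⟩
  · rintro ⟨v, hv, h⟩
    refine ⟨T v, LinearMap.mem_range_self _ _, hv, ?_⟩
    rintro _ ⟨a, rfl⟩
    exact Submodule.mem_span_singleton.2 (h a)

theorem rank_tensor {w : H2 Ω} {p : L2 Ω} (hw : w ≠ 0) (hp : p ≠ 0) : rank (tensor w p) = 1 := by
  have hpos : 0 < sobolevInner w w := by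
    refine lt_of_lt_of_le ?_ (norm_sq_le_sobolevInner_self w)
    have : (w : L2 Ω) ≠ 0 := fun h => hw (Subtype.ext h)
    positivity
  refine linearMap_rank_eq_one_iff.2 ⟨w, ?_, fun a => ?_⟩
  · rw [hsOperator_tensor]
    exact smul_ne_zero hpos.ne' hp
  · rw [hsOperator_tensor, hsOperator_tensor]
    exact ⟨sobolevInner a w * (sobolevInner w w)⁻¹, by
      rw [smul_smul, inv_mul_cancel_right₀ hpos.ne']⟩

/-- A vector orthogonal to the range of the Hilbert–Schmidt operator of `F` is orthogonal to almost
every value of `F`: test the operator with the slice `x ↦ ⟨r, F x⟩` itself. -/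
theorem ae_inner_eq_zero_of_forall_inner_hsOperator {F : H2V Ω (L2 Ω)} {r : L2 Ω}
    (h : ∀ a, inner ℝ r (hsOperator F a) = 0) :
    ∀ᵐ x ∂Ω.vol, inner ℝ r ((F : L2V Ω (L2 Ω)) x) = 0 := by
  have h1 := norm_sq_le_sobolevInner_self (H2V.map (innerSL ℝ r) F : H2 Ω)
  rw [← inner_hsOperator, h] at h1
  have h2 : ((H2V.map (innerSL ℝ r) F : H2 Ω) : L2 Ω) = 0 := by
    rw [← norm_eq_zero]
    exact pow_eq_zero_iff two_ne_zero |>.1 (le_antisymm h1 (by positivity))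
  filter_upwards [coeFn_map (innerSL ℝ r) F, Lp.coeFn_zero ℝ 2 Ω.vol] with x hx h0
  rw [h2, h0] at hx
  exact hx.symm

theorem exists_eq_tensor_of_rank_eq_one {F : H2V Ω (L2 Ω)} (hF : rank F = 1) :
    ∃ (w : H2 Ω) (p : L2 Ω), F = tensor w p := by
  obtain ⟨p, hp⟩ : ∃ p : L2 Ω, ∀ a, ∃ c : ℝ, c • p = hsOperator F a := by
    obtain ⟨v, -, hv⟩ := linearMap_rank_eq_one_iff.1 hF
    exact ⟨_, hv⟩
  refine ⟨(‖p‖ ^ 2)⁻¹ • H2V.map (innerSL ℝ p) F, p, Subtype.ext (Lp.ext ?_)⟩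
  -- it suffices to compare the inner products of both sides with each `r`
  have key : ∀ r : L2 Ω, ∀ᵐ x ∂Ω.vol, inner ℝ r ((F : L2V Ω (L2 Ω)) x
      - (tensor ((‖p‖ ^ 2)⁻¹ • H2V.map (innerSL ℝ p) F) p : L2V Ω (L2 Ω)) x) = 0 := by
    intro r
    -- remove from `r` its component along `p`
    have horth : inner ℝ (r - (inner ℝ p r * (‖p‖ ^ 2)⁻¹) • p) p = 0 := by
      rw [inner_sub_left, real_inner_smul_left, real_inner_self_eq_norm_sq, real_inner_comm]
      by_cases h0 : p = 0
      · simp [h0]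
      · have : ‖p‖ ^ 2 ≠ 0 := by positivity
        field_simp
        ring
    have h1 := ae_inner_eq_zero_of_forall_inner_hsOperator (F := F)
      (r := r - (inner ℝ p r * (‖p‖ ^ 2)⁻¹) • p) fun a => by
        obtain ⟨c, hc⟩ := hp a
        rw [← hc, real_inner_smul_right, horth, mul_zero]
    filter_upwards [h1, coeFn_tensor ((‖p‖ ^ 2)⁻¹ • H2V.map (innerSL ℝ p) F) p,
      Lp.coeFn_smul (‖p‖ ^ 2)⁻¹ ((H2V.map (innerSL ℝ p) F : H2 Ω) : L2 Ω),
      coeFn_map (innerSL ℝ p) F] with x h1 h2 h3 h4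
    have h5 : (((‖p‖ ^ 2)⁻¹ • H2V.map (innerSL ℝ p) F : H2 Ω) : L2 Ω) x
        = (‖p‖ ^ 2)⁻¹ * inner ℝ p ((F : L2V Ω (L2 Ω)) x) := by
      refine Eq.trans h3 ?_
      rw [Pi.smul_apply, h4, smul_eq_mul, innerSL_apply_apply]
    rw [inner_sub_left, real_inner_smul_left] at h1
    rw [h2, h5, inner_sub_right, real_inner_smul_right, real_inner_comm p r]
    linarith
  have : Fact ((2 : ℝ≥0∞) ≠ ⊤) := ⟨by simp⟩
  filter_upwards [ae_eq_zero_of_forall_inner (𝕜 := ℝ) key] with x hx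
  exact sub_eq_zero.1 hx

end Tensors

/-! ### Restriction to the diagonal -/

section Diagonal

variable {d : ℕ} {Ω : C2Domain d}

theorem IsDiagRestriction.unique {F : H2V Ω (L2 Ω)} {g g' : L2 Ω} (h : IsDiagRestriction F g)
    (h' : IsDiagRestriction F g') : g = g' := by
  obtain ⟨Φ, hm, hF, hc, hg⟩ := h
  obtain ⟨Φ', hm', hF', hc', hg'⟩ := h'
  -- by joint measurability, almost all slices in the other variable agree as well
  have hswap : ∀ᵐ y ∂Ω.vol, (fun x => Φ x y) =ᵐ[Ω.vol] fun x => Φ' x y := by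
    have hD := hm.sub hm'
    have h1 : ∀ᵐ z ∂(Ω.vol.prod Ω.vol), hD.mk _ z = 0 := by
      refine (Measure.ae_prod_iff_ae_ae
        (hD.stronglyMeasurable_mk.measurable (measurableSet_singleton 0))).2 ?_
      filter_upwards [hF, hF', Measure.ae_ae_of_ae_prod hD.ae_eq_mk] with x h1 h2 h3
      filter_upwards [h1, h2, h3] with y h1 h2 h3
      rw [← h3]
      simp [h1, h2]
    have h2 : ∀ᵐ z ∂(Ω.vol.prod Ω.vol), Φ z.2 z.1 = Φ' z.2 z.1 := by
      have h3 : ∀ᵐ z ∂(Ω.vol.prod Ω.vol), Φ z.1 z.2 = Φ' z.1 z.2 := by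
        filter_upwards [h1, hD.ae_eq_mk] with z h1 h2
        rw [h1] at h2
        exact sub_eq_zero.1 h2
      exact Measure.measurePreserving_swap.quasiMeasurePreserving.ae h3
    exact Measure.ae_ae_of_ae_prod h2
  refine Lp.ext ?_
  filter_upwards [hswap, hc, hc', hg, hg', ae_restrict_mem Ω.isOpen.measurableSet]
    with y h1 h2 h3 h4 h5 hy
  rw [h4, h5]
  exact Measure.eqOn_open_of_ae_eq h1 Ω.isOpen h2 h3 hy

theorem diagRestriction_eq {F : H2V Ω (L2 Ω)} {g : L2 Ω} (h : IsDiagRestriction F g) :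
    diagRestriction F = g := by
  have h' : ∃ g, IsDiagRestriction F g := ⟨g, h⟩
  rw [diagRestriction, dif_pos h']
  exact h'.choose_spec.unique h

theorem isDiagRestriction_tensor {w : H2 Ω} {U : Space d → ℝ} (hUc : ContinuousOn U Ω.carrier)
    (hU : U =ᵐ[Ω.vol] ((w : L2 Ω) : Space d → ℝ)) {p g : L2 Ω}
    (hg : ∀ᵐ y ∂Ω.vol, g y = U y * p y) : IsDiagRestriction (tensor w p) g := by
  refine ⟨fun x y => U x * p y, ?_, ?_, ?_, hg⟩
  · have hUm : AEStronglyMeasurable U Ω.vol := (Lp.aestronglyMeasurable (w : L2 Ω)).congr hU.symm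
    exact hUm.comp_fst.mul (Lp.aestronglyMeasurable p).comp_snd
  · filter_upwards [hU, coeFn_tensor w p] with x h1 h2
    rw [h2]
    filter_upwards [Lp.coeFn_smul ((w : L2 Ω) x) p] with y h3
    rw [h3, h1]
    rfl
  · exact Eventually.of_forall fun y => hUc.mul continuousOn_const

theorem exists_ae_eq_mul {U : Space d → ℝ} (hUc : ContinuousOn U (closure Ω.carrier)) (p : L2 Ω) :
    ∃ g : L2 Ω, ∀ᵐ y ∂Ω.vol, g y = U y * p y := by
  obtain ⟨C, hC⟩ := Ω.isBounded.isCompact_closure.exists_bound_of_continuousOn hUc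
  have hUm : AEStronglyMeasurable U Ω.vol :=
    (hUc.mono subset_closure).aestronglyMeasurable Ω.isOpen.measurableSet
  have hmem : MemLp (fun y => U y * p y) 2 Ω.vol := by
    refine (Lp.memLp p).of_le_mul (c := C) (hUm.mul (Lp.aestronglyMeasurable p)) ?_
    filter_upwards [ae_restrict_mem Ω.isOpen.measurableSet] with y hy
    rw [norm_mul]
    exact mul_le_mul_of_nonneg_right (hC y (subset_closure hy)) (norm_nonneg _)
  exact ⟨hmem.toLp _, hmem.coeFn_toLp⟩

end Diagonal

end InternalLifting

/-! ### The lifted inverse problem -/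

open InternalLifting in
theorem mainTheorem12 (d : ℕ) (hd₁ : 1 ≤ d) (hd₃ : d ≤ 3) (Ω : InternalLifting.C2Domain d)
    (q : InternalLifting.L2 Ω) (hq_bdd : MeasureTheory.MemLp q ⊤ Ω.vol)
    (hq_nonneg : ∀ᵐ x ∂Ω.vol, 0 ≤ q x) (hq_int : 0 < ∫ x, q x ∂Ω.vol)
    (f : InternalLifting.Space d → ℝ) (hf : ∀ x ∈ frontier Ω.carrier, 0 < f x)
    (u : InternalLifting.H2 Ω) (hu : InternalLifting.IsStrongSolution q f u)
    (F : InternalLifting.H2V Ω (InternalLifting.L2 Ω)) :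
    (InternalLifting.measurement f F =
          (u - InternalLifting.harmonicExtension f, (∫ x, q x ∂Ω.vol) • u) ∧
        InternalLifting.rank F = 1) ↔
      F = InternalLifting.tensor u q := by
  obtain ⟨U, hUc, hU, hUpos⟩ := hu.exists_pos_representative hd₁ hq_bdd hq_nonneg hf
  have hUΩ : ContinuousOn U Ω.carrier := hUc.mono subset_closure
  have hΔ : ∀ᵐ y ∂Ω.vol, laplacian u y = U y * q y := by
    filter_upwards [hu.1, hU] with y h1 h2
    rw [h2]
    linarith
  have hu0 : u ≠ 0 := by
    rintro rfl
    have h : ∀ᵐ _ ∂Ω.vol, False := by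
      filter_upwards [hU, Lp.coeFn_zero ℝ 2 Ω.vol, ae_restrict_mem Ω.isOpen.measurableSet]
        with y h1 h2 hy
      have h3 : U y = 0 := h1.trans h2
      exact (hUpos y hy).ne' h3
    rw [Filter.eventually_false_iff_eq_bot, ae_eq_bot, Measure.restrict_eq_zero] at h
    exact (Ω.isOpen.measure_pos volume Ω.isConnected.nonempty).ne' h
  have hq0 : q ≠ 0 := by
    rintro rfl
    rw [integral_congr_ae (Lp.coeFn_zero ℝ 2 Ω.vol)] at hq_int
    simp at hq_int
  constructor
  · rintro ⟨hmeas, hrank⟩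
    obtain ⟨w, p, rfl⟩ := exists_eq_tensor_of_rank_eq_one hrank
    rw [measurement, Prod.mk.injEq, map_integralL2_tensor, sub_left_inj] at hmeas
    obtain ⟨hstate, hint⟩ := hmeas
    -- the second measurement makes `w` a multiple of `u`
    have hp0 : ∫ y, p y ∂Ω.vol ≠ 0 := by
      intro h
      rw [h, zero_smul] at hint
      exact smul_ne_zero hq_int.ne' hu0 hint.symm
    obtain ⟨c, rfl⟩ : ∃ c : ℝ, w = c • u :=
      ⟨(∫ y, p y ∂Ω.vol)⁻¹ * ∫ y, q y ∂Ω.vol, by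
        rw [mul_smul, ← hint, inv_smul_smul₀ hp0]⟩
    rw [smul_tensor] at hstate ⊢
    generalize c • p = p' at hstate ⊢
    -- the first measurement identifies the diagonal `u p'` with `Δu = q u`
    obtain ⟨g, hg⟩ := exists_ae_eq_mul hUc p'
    rw [liftedState, diagRestriction_eq (isDiagRestriction_tensor hUΩ hU hg)] at hstate
    have hlap : laplacian u = g := by
      by_cases h : ∃ v : H2 Ω, laplacian v = g ∧ HasTrace v f
      · rw [poissonSolution, dif_pos h] at hstate
        exact hstate ▸ h.choose_spec.1
      · -- `u ≠ 0` is not the value `0` that `poissonSolution` assigns when there is no solution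
        rw [poissonSolution, dif_neg h] at hstate
        exact absurd hstate.symm hu0
    congr 1
    refine Lp.ext ?_
    filter_upwards [hΔ, hg, ae_restrict_mem Ω.isOpen.measurableSet] with y h1 h2 hy
    rw [hlap, h2] at h1
    exact mul_left_cancel₀ (hUpos y hy).ne' h1
  · rintro rfl
    refine ⟨?_, rank_tensor hu0 hq0⟩
    rw [measurement, map_integralL2_tensor, liftedState,
      diagRestriction_eq (isDiagRestriction_tensor hUΩ hU hΔ), poissonSolution_eq hd₁ rfl hu.2]
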